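/- Let $(Y,d)$ be a proper metric space with a $\sigma$-finite Borel measure $\mu$, and let $\Gamma$ be a countable discrete group acting on $Y$ such that every $\gamma\in\Gamma$ acts by a Lipschitz map and preserves the measure class of $\mu$. Assume that $(Y,d)$ has bounded geometry: there is $\varrho>0$ such that for every $R>0$ there is $N(R)\in\mathbb N$ for which every ball of radius $R$ in $Y$ is contained in a union of $N(R)$ balls of radius $\varrho$. Let $\ell$ be a proper length function on $\Gamma$ (that is, $\ell\colon\Gamma\to[0,\infty)$ is symmetric and subadditive, $\ell(\gamma)=0$ if and only if $\gamma=e$, and $\{\gamma : \ell(\gamma)\le r\}$ is finite for all $r$), and let $\delta_\Gamma$ be the warped metric, i.e. the largest metric on $Y$ with $\delta_\Gamma\le d$ and $\delta_\Gamma(y,\gamma y)\le\ell(\gamma)$ for all $y\in Y$, $\gamma\in\Gamma$; it induces the same topology as $d$. Let $C_0(Y)$ act on $L^2Y=L^2(Y,\mu)$ by multiplication operators $M_f$. For $\delta\in\{d,\delta_\Gamma\}$ let $\mathbb C_{\rm fp}[Y,\delta]\subseteq B(L^2Y)$ be the set of operators $T$ of finite propagation, i.e. such that there is $R\ge 0$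 with $M_fTM_g=0$ for all $f,g\in C_0(Y)$ with $\delta(\operatorname{Supp} f,\operatorname{Supp} g)>R$; let $\mathbb C_{\rm Roe}[Y,\delta]$ (the Roe $*$-algebra) be the set of those $T\in\mathbb C_{\rm fp}[Y,\delta]$ that are locally compact, i.e. such that $M_fT$ and $TM_f$ are compact for all $f\in C_c(Y)$; and let $C^*_{\rm fp}(Y,\delta)$ and $C^*_{\rm Roe}(Y,\delta)$ be the norm closures of these two sets. Let $\pi$ be the Koopman representation of $\Gamma$ on $L^2Y$, $\pi(\gamma)\xi(x)=\bigl(\frac{d\gamma_*\mu}{d\mu}(x)\bigr)^{1/2}\xi(\gamma^{-1}x)$. For a linear subspace $B\subseteq B(L^2Y)$ let $\Gamma\cdot B$ denote the linear span of $\{\pi(\gamma)b : \gamma\in\Gamma,\ b\in B\}$, and say that $\pi$ normalizes $B$ if $\pi(\gamma)b\pi(\gamma)^*\in B$ for all $\gamma\in\Gamma$, $b\in B$. Then $\pi$ normalizes $\mathbb C_{\rm fp}[Y,d]$ and $C^*_{\rm fp}(Y,d)$, and $$\mathbb C_{\rm fp}[Y,\delta_\Gamma]=\Gamma\cdot\mathbb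 C_{\rm fp}[Y,d],\qquad C^*_{\rm fp}(Y,\delta_\Gamma)=\overline{\Gamma\cdot C^*_{\rm fp}(Y,d)}^{\,\|\cdot\|}.$$ If moreover $L^2Y$ is an ample $Y$-module, i.e. $M_f$ is non-compact for every non-zero $f\in C_0(Y)$ (so that $C^*_{\rm Roe}(Y,d)$ and $C^*_{\rm Roe}(Y,\delta_\Gamma)$ are the Roe algebras of $(Y,d)$ and $(Y,\delta_\Gamma)$), then $\pi$ normalizes $\mathbb C_{\rm Roe}[Y,d]$ and $C^*_{\rm Roe}(Y,d)$, and $$\mathbb C_{\rm Roe}[Y,\delta_\Gamma]=\Gamma\cdot\mathbb C_{\rm Roe}[Y,d],\qquad C^*_{\rm Roe}(Y,\delta_\Gamma)=\overline{\Gamma\cdot C^*_{\rm Roe}(Y,d)}^{\,\|\cdot\|}.$$ -/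

import Mathlib

open MeasureTheory
open scoped ENNReal ZeroAtInfty

noncomputable section

namespace WarpedRoe

/-! ### Multiplication operators on `L²(Y, μ)` -/

section Multiplication

variable {Y : Type*} [TopologicalSpace Y] [MeasurableSpace Y] [OpensMeasurableSpace Y]

theorem memLp_top_zeroAtInfty (μ : Measure Y) (f : C₀(Y, ℂ)) : MemLp (f : Y → ℂ) ∞ μ := by
  refine memLp_top_of_bound ?_ ‖f.toBCF‖
    (Filter.Eventually.of_forall fun y => f.toBCF.norm_coe_le_norm y)
  refine AEStronglyMeasurable.congr (f := (f : Y → ℂ)) ?_ Filter.EventuallyEq.rfl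
  exact f.continuous.measurable.aestronglyMeasurable

/-- The multiplication operator `M_f` on `L²(Y, μ)`, for `f ∈ C₀(Y)`. -/
def mulOp (μ : Measure Y) (f : C₀(Y, ℂ)) : Lp ℂ 2 μ →L[ℂ] Lp ℂ 2 μ :=
  (ContinuousLinearMap.mul ℂ ℂ).holderL μ ∞ 2 2 ((memLp_top_zeroAtInfty μ f).toLp f)

theorem coeFn_mulOp (μ : Measure Y) (f : C₀(Y, ℂ)) (ξ : Lp ℂ 2 μ) :
    mulOp μ f ξ =ᵐ[μ] fun y => f y * ξ y := by
  filter_upwards [(ContinuousLinearMap.mul ℂ ℂ).coeFn_holder (r := 2)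
    ((memLp_top_zeroAtInfty μ f).toLp f) ξ, (memLp_top_zeroAtInfty μ f).coeFn_toLp] with y h1 h2
  have : mulOp μ f ξ y = (ContinuousLinearMap.mul ℂ ℂ)
      ((memLp_top_zeroAtInfty μ f).toLp f y) (ξ y) := h1
  rw [this, h2]
  rfl

end Multiplication

/-! ### Algebras of operators of finite propagation and Roe algebras -/

section Roe

variable {Y : Type*} [TopologicalSpace Y] [MeasurableSpace Y] [OpensMeasurableSpace Y]

/-- `L²(Y, μ)`, with `C₀(Y)` acting by multiplication, is an ample module: every non-zero
function acts by a non-compact operator. -/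
def IsAmple (μ : Measure Y) : Prop :=
  ∀ f : C₀(Y, ℂ), f ≠ 0 → ¬ IsCompactOperator (mulOp μ f)

/-- The distance between the sets `A` and `B`, measured with `d`, is larger than `R`
(the distance to an empty set being infinite). -/
def SetDistGT (d : Y → Y → ℝ) (A B : Set Y) (R : ℝ) : Prop :=
  ∃ r : ℝ, R < r ∧ ∀ x ∈ A, ∀ y ∈ B, r ≤ d x y

/-- `T` has propagation at most `R` with respect to the distance function `d`. -/
def HasPropagationLE (d : Y → Y → ℝ) (μ : Measure Y) (T : Lp ℂ 2 μ →L[ℂ] Lp ℂ 2 μ)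
    (R : ℝ) : Prop :=
  ∀ f g : C₀(Y, ℂ), SetDistGT d (tsupport f) (tsupport g) R →
    mulOp μ f ∘L T ∘L mulOp μ g = 0

theorem HasPropagationLE.mono {d : Y → Y → ℝ} {μ : Measure Y}
    {T : Lp ℂ 2 μ →L[ℂ] Lp ℂ 2 μ} {R S : ℝ} (h : HasPropagationLE d μ T R) (hRS : R ≤ S) :
    HasPropagationLE d μ T S :=
  fun f g ⟨r, hr, hfg⟩ => h f g ⟨r, hRS.trans_lt hr, hfg⟩

/-- `T` is locally compact: `M_f T` and `T M_f` are compact for all `f ∈ C_c(Y)`. -/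
def IsLocallyCompactOp (μ : Measure Y) (T : Lp ℂ 2 μ →L[ℂ] Lp ℂ 2 μ) : Prop :=
  ∀ f : C₀(Y, ℂ), HasCompactSupport f →
    IsCompactOperator (mulOp μ f ∘L T) ∧ IsCompactOperator (T ∘L mulOp μ f)

/-- The operators on `L²(Y, μ)` of finite propagation with respect to `d`. -/
def fpStar (d : Y → Y → ℝ) (μ : Measure Y) : Submodule ℂ (Lp ℂ 2 μ →L[ℂ] Lp ℂ 2 μ) where
  carrier := {T | ∃ R : ℝ, 0 ≤ R ∧ HasPropagationLE d μ T R}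
  zero_mem' := ⟨0, le_rfl, fun f g _ => by simp⟩
  add_mem' := by
    rintro S T ⟨R, hR, hS⟩ ⟨R', hR', hT⟩
    refine ⟨max R R', le_max_of_le_left hR, fun f g hfg => ?_⟩
    have h1 := hS.mono (le_max_left R R') f g hfg
    have h2 := hT.mono (le_max_right R R') f g hfg
    simp only [ContinuousLinearMap.add_comp, ContinuousLinearMap.comp_add, h1, h2, add_zero]
  smul_mem' := by
    rintro c T ⟨R, hR, hT⟩
    refine ⟨R, hR, fun f g hfg => ?_⟩
    simp only [ContinuousLinearMap.smul_comp, ContinuousLinearMap.comp_smul, hT f g hfg,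
      smul_zero]

/-- The locally compact operators on `L²(Y, μ)`. -/
def locallyCompactOps (μ : Measure Y) : Submodule ℂ (Lp ℂ 2 μ →L[ℂ] Lp ℂ 2 μ) where
  carrier := {T | IsLocallyCompactOp μ T}
  zero_mem' := fun f _ => by
    simp only [ContinuousLinearMap.comp_zero, ContinuousLinearMap.zero_comp]
    exact ⟨isCompactOperator_zero, isCompactOperator_zero⟩
  add_mem' := by
    intro S T hS hT f hf
    simp only [ContinuousLinearMap.add_comp, ContinuousLinearMap.comp_add]
    exact ⟨(hS f hf).1.add (hT f hf).1, (hS f hf).2.add (hT f hf).2⟩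
  smul_mem' := by
    intro c T hT f hf
    simp only [ContinuousLinearMap.smul_comp, ContinuousLinearMap.comp_smul]
    exact ⟨(hT f hf).1.smul c, (hT f hf).2.smul c⟩

/-- The norm closure of the operators of finite propagation. -/
def fpCStar (d : Y → Y → ℝ) (μ : Measure Y) : Submodule ℂ (Lp ℂ 2 μ →L[ℂ] Lp ℂ 2 μ) :=
  (fpStar d μ).topologicalClosure

/-- The Roe *-algebra: locally compact operators of finite propagation. -/
def roeStar (d : Y → Y → ℝ) (μ : Measure Y) : Submodule ℂ (Lp ℂ 2 μ →L[ℂ] Lp ℂ 2 μ) :=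
  fpStar d μ ⊓ locallyCompactOps μ

/-- The Roe algebra: the norm closure of the Roe *-algebra. -/
def roeCStar (d : Y → Y → ℝ) (μ : Measure Y) : Submodule ℂ (Lp ℂ 2 μ →L[ℂ] Lp ℂ 2 μ) :=
  (roeStar d μ).topologicalClosure

end Roe

/-- Bounded geometry: there is a gauge `ϱ > 0` such that, for every `R > 0`, all balls of radius
`R` are covered by a uniformly bounded number of balls of radius `ϱ`. -/
def HasBoundedGeometry (Y : Type*) [MetricSpace Y] : Prop :=
  ∃ ϱ : ℝ, 0 < ϱ ∧ ∀ R : ℝ, 0 < R → ∃ N : ℕ, ∀ y : Y, ∃ F : Finset Y,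
    F.card ≤ N ∧ Metric.ball y R ⊆ ⋃ z ∈ F, Metric.ball z ϱ

/-! ### Non-singular actions and the Koopman representation -/

section Koopman

variable {Γ : Type*} [Group Γ] {Y : Type*} [MeasurableSpace Y] [MulAction Γ Y]

/-- The action is measurable and preserves null sets; applied to `γ` and `γ⁻¹` this says that
the measure class of `μ` is preserved. -/
def IsNonsingular (Γ : Type*) [Group Γ] {Y : Type*} [MeasurableSpace Y] [MulAction Γ Y]
    (μ : Measure Y) : Prop :=
  ∀ γ : Γ, Measure.QuasiMeasurePreserving (fun y : Y => γ • y) μ μ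

/-- The Radon-Nikodym cocycle `r(γ, x) = d(γ_* μ)/dμ (x)`. -/
def rnCocycle (μ : Measure Y) (γ : Γ) (x : Y) : ℝ≥0∞ :=
  (μ.map (fun y : Y => γ • y)).rnDeriv μ x

/-- The function `x ↦ r(γ, x)^{1/2} ξ(γ⁻¹ x)`. -/
def koopmanFun (μ : Measure Y) (γ : Γ) (ξ : Y → ℂ) (x : Y) : ℂ :=
  (Real.sqrt (rnCocycle μ γ x).toReal : ℂ) * ξ (γ⁻¹ • x)

theorem koopmanFun_congr {μ : Measure Y} (h : IsNonsingular Γ μ) (γ : Γ) {ξ η : Y → ℂ} (hξη : ξ =ᵐ[μ] η) :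
    koopmanFun μ γ ξ =ᵐ[μ] koopmanFun μ γ η := by
  filter_upwards [(h γ⁻¹).ae_eq hξη] with x hx
  simp only [Function.comp] at hx
  simp only [koopmanFun, hx]

variable {μ : Measure Y} [SigmaFinite μ]

theorem sigmaFinite_map_smul (h : IsNonsingular Γ μ) (γ : Γ) :
    SigmaFinite (μ.map (fun y : Y => γ • y)) :=
  MeasurableEquiv.sigmaFinite_map
    { toEquiv := MulAction.toPerm γ
      measurable_toFun := (h γ).measurable
      measurable_invFun := (h γ⁻¹).measurable }

theorem eLpNorm_koopmanFun (h : IsNonsingular Γ μ) (γ : Γ) {ξ : Y → ℂ}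
    (hξ : AEStronglyMeasurable ξ μ) : eLpNorm (koopmanFun μ γ ξ) 2 μ = eLpNorm ξ 2 μ := by
  have := sigmaFinite_map_smul h γ
  have hm : AEMeasurable (fun x => ‖ξ (γ⁻¹ • x)‖ₑ ^ (2 : ℝ)) μ :=
    ((hξ.comp_quasiMeasurePreserving (h γ⁻¹)).enorm).pow_const _
  have hm' : AEMeasurable (fun x => ‖ξ (γ⁻¹ • x)‖ₑ ^ (2 : ℝ)) (μ.map (fun y : Y => γ • y)) :=
    hm.mono_ac (h γ).absolutelyContinuous
  simp only [eLpNorm_eq_lintegral_rpow_enorm_toReal two_ne_zero ENNReal.ofNat_ne_top,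
    ENNReal.toReal_ofNat]
  congr 1
  calc ∫⁻ x, ‖koopmanFun μ γ ξ x‖ₑ ^ (2 : ℝ) ∂μ
      = ∫⁻ x, (μ.map (fun y : Y => γ • y)).rnDeriv μ x * ‖ξ (γ⁻¹ • x)‖ₑ ^ (2 : ℝ) ∂μ := by
        refine lintegral_congr_ae ?_
        filter_upwards [(μ.map (fun y : Y => γ • y)).rnDeriv_lt_top μ] with x hx
        have h1 : ‖((Real.sqrt (rnCocycle μ γ x).toReal : ℝ) : ℂ)‖ₑ ^ (2 : ℝ)
            = rnCocycle μ γ x := by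
          rw [← ofReal_norm, Complex.norm_real, Real.norm_of_nonneg (Real.sqrt_nonneg _),
            ENNReal.ofReal_rpow_of_nonneg (Real.sqrt_nonneg _) (by norm_num), Real.rpow_two,
            Real.sq_sqrt ENNReal.toReal_nonneg, ENNReal.ofReal_toReal]
          exact hx.ne
        simp only [koopmanFun, enorm_mul]
        rw [ENNReal.mul_rpow_of_nonneg _ _ (by norm_num), h1]
        rfl
    _ = ∫⁻ x, ‖ξ (γ⁻¹ • x)‖ₑ ^ (2 : ℝ) ∂(μ.map (fun y : Y => γ • y)) :=
        lintegral_rnDeriv_mul (h γ).absolutelyContinuous hm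
    _ = ∫⁻ x, ‖ξ x‖ₑ ^ (2 : ℝ) ∂μ := by
        rw [lintegral_map' hm' (h γ).measurable.aemeasurable]
        simp only [inv_smul_smul]

theorem memLp_koopmanFun (h : IsNonsingular Γ μ) (γ : Γ) (ξ : Lp ℂ 2 μ) :
    MemLp (koopmanFun μ γ ξ) 2 μ := by
  refine ⟨?_, ?_⟩
  · refine AEStronglyMeasurable.mul ?_
      ((Lp.aestronglyMeasurable ξ).comp_quasiMeasurePreserving (h γ⁻¹))
    exact (Complex.measurable_ofReal.comp
      (Measure.measurable_rnDeriv _ _).ennreal_toReal.sqrt).aestronglyMeasurable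
  · rw [eLpNorm_koopmanFun h γ (Lp.aestronglyMeasurable ξ)]
    exact Lp.eLpNorm_lt_top ξ

/-- The Koopman representation `(π(γ) ξ)(x) = r(γ, x)^{1/2} ξ(γ⁻¹ x)` on `L²(Y, μ)`. -/
def koopman (h : IsNonsingular Γ μ) (γ : Γ) : Lp ℂ 2 μ →L[ℂ] Lp ℂ 2 μ :=
  LinearIsometry.toContinuousLinearMap
    { toFun := fun ξ => (memLp_koopmanFun h γ ξ).toLp _
      map_add' := fun ξ η => by
        rw [← MemLp.toLp_add, MemLp.toLp_eq_toLp_iff]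
        refine (koopmanFun_congr h γ (Lp.coeFn_add ξ η)).trans (.of_forall fun x => ?_)
        simp only [koopmanFun, Pi.add_apply, mul_add]
      map_smul' := fun c ξ => by
        rw [RingHom.id_apply, ← MemLp.toLp_const_smul, MemLp.toLp_eq_toLp_iff]
        refine (koopmanFun_congr h γ (Lp.coeFn_smul c ξ)).trans (.of_forall fun x => ?_)
        simp only [koopmanFun, Pi.smul_apply, smul_eq_mul]
        ring
      norm_map' := fun ξ => by
        change ‖(memLp_koopmanFun h γ ξ).toLp _‖ = ‖ξ‖
        rw [Lp.norm_toLp, eLpNorm_koopmanFun h γ (Lp.aestronglyMeasurable ξ), Lp.norm_def] }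

theorem coeFn_koopman (h : IsNonsingular Γ μ) (γ : Γ) (ξ : Lp ℂ 2 μ) :
    koopman h γ ξ =ᵐ[μ] koopmanFun μ γ ξ :=
  (memLp_koopmanFun h γ ξ).coeFn_toLp

/-- `Γ · B`: the linear span of the operators `π(γ) b`, with `γ ∈ Γ` and `b ∈ B`. -/
def groupSpan (h : IsNonsingular Γ μ) (B : Submodule ℂ (Lp ℂ 2 μ →L[ℂ] Lp ℂ 2 μ)) :
    Submodule ℂ (Lp ℂ 2 μ →L[ℂ] Lp ℂ 2 μ) :=
  Submodule.span ℂ {T | ∃ γ : Γ, ∃ b ∈ B, T = koopman h γ ∘L b}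

/-- The Koopman representation normalizes `B`: `π(γ) b π(γ)* ∈ B` for all `γ ∈ Γ`, `b ∈ B`. -/
def Normalizes (h : IsNonsingular Γ μ) (B : Submodule ℂ (Lp ℂ 2 μ →L[ℂ] Lp ℂ 2 μ)) : Prop :=
  ∀ γ : Γ, ∀ b ∈ B, koopman h γ ∘L b ∘L ContinuousLinearMap.adjoint (koopman h γ) ∈ B

end Koopman

/-! ### Warped metrics -/

/-- A proper length function on a group. -/
structure ProperLengthFunction (Γ : Type*) [Group Γ] where
  /-- The length of an element. -/
  len : Γ → ℝ
  nonneg : ∀ γ, 0 ≤ len γ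
  eq_zero_iff : ∀ γ, len γ = 0 ↔ γ = 1
  symm : ∀ γ, len γ⁻¹ = len γ
  subadd : ∀ γ γ', len (γ * γ') ≤ len γ + len γ'
  proper : ∀ r : ℝ, {γ | len γ ≤ r}.Finite

/-- `ρ` is a metric on the set `Y`. -/
structure IsMetric {Y : Type*} (ρ : Y → Y → ℝ) : Prop where
  eq_zero_iff : ∀ x y, ρ x y = 0 ↔ x = y
  symm : ∀ x y, ρ x y = ρ y x
  triangle : ∀ x y z, ρ x z ≤ ρ x y + ρ y z

theorem IsMetric.nonneg {Y : Type*} {ρ : Y → Y → ℝ} (h : IsMetric ρ) (x y : Y) :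
    0 ≤ ρ x y := by
  have h1 := h.triangle x y x
  rw [(h.eq_zero_iff x x).2 rfl, h.symm y x] at h1
  linarith

section Warped

variable {Γ : Type*} [Group Γ] {Y : Type*} [MetricSpace Y] [MulAction Γ Y]

/-- The metrics `ρ` on `Y` with `ρ ≤ d` and `ρ(y, γ y) ≤ ℓ(γ)` for all `y` and `γ`. -/
def warpedCandidates (Y : Type*) [MetricSpace Y] [MulAction Γ Y] (ℓ : ProperLengthFunction Γ) :
    Set (Y → Y → ℝ) :=
  {ρ | IsMetric ρ ∧ (∀ x y, ρ x y ≤ dist x y) ∧ ∀ (γ : Γ) (y : Y), ρ y (γ • y) ≤ ℓ.len γ}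

/-- The warped metric `δ_Γ`: the largest metric `ρ` on `Y` with `ρ ≤ d` and
`ρ(y, γ y) ≤ ℓ(γ)` for all `y` and `γ`, see `isGreatest_warpedDist`. -/
def warpedDist (ℓ : ProperLengthFunction Γ) (x y : Y) : ℝ :=
  sSup {t | ∃ ρ ∈ warpedCandidates Y ℓ, t = ρ x y}

theorem exists_le_len (ℓ : ProperLengthFunction Γ) :
    ∃ c : ℝ, 0 < c ∧ ∀ γ : Γ, γ ≠ 1 → c ≤ ℓ.len γ := by
  have hfin : ({γ | ℓ.len γ ≤ 1} \ {1}).Finite := (ℓ.proper 1).subset Set.sdiff_subset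
  by_cases hne : ({γ | ℓ.len γ ≤ 1} \ {1}).Nonempty
  · obtain ⟨γ₀, h₀, hmin⟩ := Set.exists_min_image _ ℓ.len hfin hne
    have hpos : 0 < ℓ.len γ₀ :=
      lt_of_le_of_ne (ℓ.nonneg _) fun h => h₀.2 ((ℓ.eq_zero_iff _).1 h.symm)
    refine ⟨ℓ.len γ₀, hpos, fun γ hγ => ?_⟩
    by_cases h1 : ℓ.len γ ≤ 1
    · exact hmin γ ⟨h1, hγ⟩
    · exact (h₀.1.trans_lt (not_le.1 h1)).le
  · refine ⟨1, one_pos, fun γ hγ => ?_⟩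
    by_contra h1
    exact hne ⟨γ, (not_le.1 h1).le, hγ⟩

theorem min_mem_warpedCandidates (ℓ : ProperLengthFunction Γ) {c : ℝ} (hc : 0 < c)
    (h : ∀ γ : Γ, γ ≠ 1 → c ≤ ℓ.len γ) :
    (fun x y : Y => min (dist x y) c) ∈ warpedCandidates Y ℓ := by
  refine ⟨⟨fun x y => ?_, fun x y => by rw [dist_comm], fun x y z => ?_⟩,
    fun x y => min_le_left _ _, fun γ y => ?_⟩
  · constructor
    · intro h0
      rcases min_choice (dist x y) c with h1 | h1
      · exact dist_eq_zero.1 (h1.symm.trans h0)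
      · exact absurd (h1.symm.trans h0) hc.ne'
    · rintro rfl
      simp [hc.le]
  · have h1 := dist_triangle x y z
    have h2 := dist_nonneg (x := x) (y := y)
    have h3 := dist_nonneg (x := y) (y := z)
    change min (dist x z) c ≤ min (dist x y) c + min (dist y z) c
    rcases min_cases (dist x y) c with h4 | h4 <;> rcases min_cases (dist y z) c with h5 | h5 <;>
      rcases min_cases (dist x z) c with h6 | h6 <;> linarith
  · by_cases hγ : γ = 1
    · subst hγ
      simp [(ℓ.eq_zero_iff 1).2 rfl, hc.le]
    · exact (min_le_right _ _).trans (h γ hγ)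

theorem le_warpedDist (ℓ : ProperLengthFunction Γ) {ρ : Y → Y → ℝ}
    (hρ : ρ ∈ warpedCandidates Y ℓ) (x y : Y) : ρ x y ≤ warpedDist ℓ x y := by
  refine le_csSup ⟨dist x y, ?_⟩ ⟨ρ, hρ, rfl⟩
  rintro _ ⟨σ, hσ, rfl⟩
  exact hσ.2.1 x y

theorem warpedDist_le (ℓ : ProperLengthFunction Γ) {x y : Y} {b : ℝ}
    (h : ∀ ρ ∈ warpedCandidates Y ℓ, ρ x y ≤ b) : warpedDist ℓ x y ≤ b := by
  obtain ⟨c, hc, hc'⟩ := exists_le_len ℓ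
  refine csSup_le ⟨_, _, min_mem_warpedCandidates ℓ hc hc', rfl⟩ ?_
  rintro _ ⟨σ, hσ, rfl⟩
  exact h σ hσ

/-- The warped metric is the largest metric with the required properties. -/
theorem isGreatest_warpedDist (ℓ : ProperLengthFunction Γ) :
    IsGreatest (warpedCandidates Y ℓ) (warpedDist ℓ) := by
  obtain ⟨c, hc, hc'⟩ := exists_le_len ℓ
  have hm := min_mem_warpedCandidates (Y := Y) ℓ hc hc'
  refine ⟨⟨⟨fun x y => ⟨fun h0 => ?_, ?_⟩, fun x y => ?_, fun x y z => ?_⟩,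
    fun x y => warpedDist_le ℓ fun ρ hρ => hρ.2.1 x y,
    fun γ y => warpedDist_le ℓ fun ρ hρ => hρ.2.2 γ y⟩,
    fun ρ hρ x y => le_warpedDist ℓ hρ x y⟩
  · refine (hm.1.eq_zero_iff x y).1 (le_antisymm ?_ (hm.1.nonneg x y))
    exact (le_warpedDist ℓ hm x y).trans h0.le
  · rintro rfl
    refine le_antisymm (warpedDist_le ℓ fun ρ hρ => ((hρ.1.eq_zero_iff x x).2 rfl).le) ?_
    exact (hm.1.nonneg x x).trans (le_warpedDist ℓ hm x x)
  · exact le_antisymm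
      (warpedDist_le ℓ fun ρ hρ => (hρ.1.symm x y).le.trans (le_warpedDist ℓ hρ y x))
      (warpedDist_le ℓ fun ρ hρ => (hρ.1.symm y x).le.trans (le_warpedDist ℓ hρ x y))
  · exact warpedDist_le ℓ fun ρ hρ => (hρ.1.triangle x y z).trans
      (add_le_add (le_warpedDist ℓ hρ x y) (le_warpedDist ℓ hρ y z))

/-- The warped metric induces the same topology as `d`, so that `C₀(Y)`, `C_c(Y)`, supports and
the Borel sets are the same for both metrics. -/
theorem isOpen_iff_warpedDist (ℓ : ProperLengthFunction Γ) (s : Set Y) :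
    IsOpen s ↔ ∀ x ∈ s, ∃ ε > 0, ∀ y, warpedDist ℓ x y < ε → y ∈ s := by
  obtain ⟨c, hc, hc'⟩ := exists_le_len ℓ
  have hm := min_mem_warpedCandidates (Y := Y) ℓ hc hc'
  rw [Metric.isOpen_iff]
  refine forall₂_congr fun x _ => ⟨?_, ?_⟩
  · rintro ⟨ε, hε, hs⟩
    refine ⟨min ε c, lt_min hε hc, fun y hy => hs ?_⟩
    have h1 : min (dist x y) c < min ε c := (le_warpedDist ℓ hm x y).trans_lt hy
    rw [Metric.mem_ball, dist_comm]
    by_contra h2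
    exact absurd h1 (not_lt.2 (min_le_min_right c (not_lt.1 h2)))
  · rintro ⟨ε, hε, hs⟩
    refine ⟨ε, hε, fun y hy => hs y ?_⟩
    rw [Metric.mem_ball, dist_comm] at hy
    exact ((isGreatest_warpedDist ℓ).1.2.1 x y).trans_lt hy

end Warped

end WarpedRoe

end

/-! One inclusion is soft. `π(γ)` displaces points by at most `ℓ(γ)` for the warped metric, so `π(γ)
T` has finite warped propagation whenever `T` has finite `d`-propagation
(`koopman_comp_mem_fpStar_warpedDist`).

For the converse, the warped distance is an infimum of costs of chains of `d`-moves and group jumps.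
The jumps of a chain of bounded cost multiply to one of finitely many `γ`, and the Lipschitz bounds
control how much the jumps stretch the moves. Hence points at bounded warped distance satisfy `dist
(γ • x) y ≤ R'` for some `γ` in a fixed finite set `S` (`exists_dist_smul_le_of_warpedDist_lt`).

Let `T` have finite warped propagation, and let `u i` be a partition of unity on balls around the
points `i` of a net. Then `M_{u i} T` only sees functions near the translates `γ⁻¹ B(i, R')` with `γ
∈ S`, and weights `w i γ` summing to `1` there give `M_{u i} T = ∑ γ ∈ S, M_{u i} T M_{w i γ}`
(`HasPropagationLE.comp_sum_weight`). Put `T γ = ∑ i, M_{u i} T M_{w i γ}`. Bounded geometry bounds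
the overlaps, so this converges strongly, as a row times a column of operators
(`exists_isBlockSum`). Now `T = ∑ γ ∈ S, T γ`, and each `π(γ⁻¹) T γ` has finite `d`-propagation
(`exists_decomposition`).

Local compactness survives because a compact set meets only finitely many blocks. The statements on
norm closures follow by continuity of left multiplication by `π(γ)`. -/

open scoped InnerProductSpace

noncomputable section

namespace WarpedRoe

/-! ### Square-summable families of operators -/

section Hilbert

variable {H : Type*} [NormedAddCommGroup H] [InnerProductSpace ℂ H]
variable {ι : Type*}

/-- The family of operators `A i` is square-summable with bound `C`. -/
def IsSqSummable (A : ι → H →L[ℂ] H) (C : ℝ) : Prop :=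
  ∀ (F : Finset ι) (ξ : H), ∑ i ∈ F, ‖A i ξ‖ ^ 2 ≤ C * ‖ξ‖ ^ 2

/-- The column operator `H → ℓ²(ι, H)` of a square-summable family. -/
def columnOp {A : ι → H →L[ℂ] H} {C : ℝ} (hC : 0 ≤ C) (hA : IsSqSummable A C) :
    H →L[ℂ] lp (fun _ : ι => H) 2 :=
  LinearMap.mkContinuous
    { toFun := fun ξ => ⟨fun i => A i ξ, memℓp_gen' (C := C * ‖ξ‖ ^ 2) fun F => by
        simpa using hA F ξ⟩
      map_add' := fun ξ η => lp.ext (funext fun i => map_add (A i) ξ η)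
      map_smul' := fun c ξ => lp.ext (funext fun i => map_smul (A i) c ξ) }
    (Real.sqrt C) fun ξ => by
      refine lp.norm_le_of_forall_sum_le (by simp) (by positivity) fun F => ?_
      have := hA F ξ
      simpa [mul_pow, Real.sq_sqrt hC] using this

theorem columnOp_apply {A : ι → H →L[ℂ] H} {C : ℝ} (hC : 0 ≤ C) (hA : IsSqSummable A C)
    (ξ : H) (i : ι) : columnOp hC hA ξ i = A i ξ := rfl

variable [CompleteSpace H]

theorem adjoint_columnOp_single [DecidableEq ι] {A : ι → H →L[ℂ] H} {C : ℝ} (hC : 0 ≤ C)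
    (hA : IsSqSummable A C) (i : ι) (v : H) :
    ContinuousLinearMap.adjoint (columnOp hC hA) (lp.single 2 i v) =
      ContinuousLinearMap.adjoint (A i) v := by
  refine ext_inner_right ℂ fun w => ?_
  rw [ContinuousLinearMap.adjoint_inner_left, ContinuousLinearMap.adjoint_inner_left,
    lp.inner_single_left, columnOp_apply]

/-- The sum is the adjoint of the column of `A` composed with the column of `B`. A vector of `ℓ²` is
the norm-convergent sum of its coordinates, and the bounded adjoint carries this convergence over.
-/
theorem exists_hasSum_adjoint_comp {A B : ι → H →L[ℂ] H} {C D : ℝ} (hC : 0 ≤ C) (hD : 0 ≤ D)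
    (hA : IsSqSummable A C) (hB : IsSqSummable B D) :
    ∃ T : H →L[ℂ] H, ∀ ξ, HasSum (fun i => ContinuousLinearMap.adjoint (A i) (B i ξ)) (T ξ) := by
  classical
  refine ⟨ContinuousLinearMap.adjoint (columnOp hC hA) ∘L columnOp hD hB, fun ξ => ?_⟩
  have h := (lp.hasSum_single (p := 2) (by simp) (columnOp hD hB ξ)).mapL
    (ContinuousLinearMap.adjoint (columnOp hC hA))
  simp only [adjoint_columnOp_single, columnOp_apply] at h
  exact h

end Hilbert

/-! ### The algebra of multiplication operators -/

section Multiplication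

variable {Y : Type*} [TopologicalSpace Y] [MeasurableSpace Y] [OpensMeasurableSpace Y]

theorem mulOp_add (μ : Measure Y) (f g : C₀(Y, ℂ)) :
    mulOp μ (f + g) = mulOp μ f + mulOp μ g := by
  ext1 ξ
  refine Lp.ext ?_
  filter_upwards [coeFn_mulOp μ (f + g) ξ, coeFn_mulOp μ f ξ, coeFn_mulOp μ g ξ,
    Lp.coeFn_add (mulOp μ f ξ) (mulOp μ g ξ)] with y h1 h2 h3 h4
  rw [_root_.add_apply, h4, h1, Pi.add_apply, h2, h3, ZeroAtInftyContinuousMap.add_apply,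
    add_mul]

/-- `f ↦ M_f` as an additive map. -/
def mulOpHom (μ : Measure Y) : C₀(Y, ℂ) →+ (Lp ℂ 2 μ →L[ℂ] Lp ℂ 2 μ) :=
  AddMonoidHom.mk' (mulOp μ) (mulOp_add μ)

theorem mulOp_zero (μ : Measure Y) : mulOp μ (0 : C₀(Y, ℂ)) = 0 := map_zero (mulOpHom μ)

theorem mulOp_sub (μ : Measure Y) (f g : C₀(Y, ℂ)) :
    mulOp μ (f - g) = mulOp μ f - mulOp μ g := map_sub (mulOpHom μ) f g

theorem mulOp_sum (μ : Measure Y) {ι : Type*} (F : Finset ι) (f : ι → C₀(Y, ℂ)) :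
    mulOp μ (∑ i ∈ F, f i) = ∑ i ∈ F, mulOp μ (f i) := map_sum (mulOpHom μ) f F

theorem mulOp_mul (μ : Measure Y) (f g : C₀(Y, ℂ)) :
    mulOp μ (f * g) = mulOp μ f ∘L mulOp μ g := by
  ext1 ξ
  refine Lp.ext ?_
  filter_upwards [coeFn_mulOp μ (f * g) ξ, coeFn_mulOp μ f (mulOp μ g ξ),
    coeFn_mulOp μ g ξ] with y h1 h2 h3
  rw [ContinuousLinearMap.comp_apply, h1, h2, h3, ZeroAtInftyContinuousMap.mul_apply, mul_assoc]

theorem adjoint_mulOp (μ : Measure Y) (f : C₀(Y, ℂ)) :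
    ContinuousLinearMap.adjoint (mulOp μ f) = mulOp μ (star f) := by
  symm
  rw [ContinuousLinearMap.eq_adjoint_iff]
  intro ξ η
  rw [L2.inner_def, L2.inner_def]
  refine integral_congr_ae ?_
  filter_upwards [coeFn_mulOp μ (star f) ξ, coeFn_mulOp μ f η] with y h1 h2
  rw [h1, h2, ZeroAtInftyContinuousMap.star_apply]
  simp only [RCLike.inner_apply, map_mul, RCLike.star_def, RCLike.conj_conj]
  ring

/-- Integrating the pointwise bound against `‖ξ‖²` turns bounded overlap of functions into
square-summability of operators. -/
theorem sum_norm_sq_mulOp_le (μ : Measure Y) {ι : Type*} {g : ι → C₀(Y, ℂ)} {C : ℝ}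
    (hg : ∀ (F : Finset ι) (y : Y), ∑ i ∈ F, ‖g i y‖ ^ 2 ≤ C) :
    IsSqSummable (fun i => mulOp μ (g i)) C := by
  intro F ξ
  have key : ∀ η : Lp ℂ 2 μ, ‖η‖ ^ 2 = ∫ y, ‖η y‖ ^ 2 ∂μ := fun η => by
    have h := L2.inner_def (𝕜 := ℂ) η η
    simp only [inner_self_eq_norm_sq_to_K] at h
    have h' : (‖η‖ : ℂ) ^ 2 = ∫ y, ((‖η y‖ : ℂ)) ^ 2 ∂μ := h
    have h2 : ∫ y, ((‖η y‖ : ℂ)) ^ 2 ∂μ = ((∫ y, ‖η y‖ ^ 2 ∂μ : ℝ) : ℂ) := by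
      rw [← integral_complex_ofReal]
      simp
    exact Complex.ofReal_injective ((Complex.ofReal_pow _ _).trans (h'.trans h2))
  have hint : ∀ η : Lp ℂ 2 μ, Integrable (fun y => ‖η y‖ ^ 2) μ := fun η =>
    (memLp_two_iff_integrable_sq_norm (Lp.aestronglyMeasurable η)).1 (Lp.memLp η)
  simp only [key]
  rw [← integral_finsetSum _ fun i _ => hint _, ← integral_const_mul]
  refine integral_mono_ae (integrable_finsetSum _ fun i _ => hint _) ((hint ξ).const_mul C) ?_
  have hall : ∀ᵐ y ∂μ, ∀ i ∈ F, mulOp μ (g i) ξ y = g i y * ξ y :=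
    (Finset.eventually_all F).2 fun i _ => coeFn_mulOp μ (g i) ξ
  filter_upwards [hall] with y hy
  calc ∑ i ∈ F, ‖mulOp μ (g i) ξ y‖ ^ 2 = (∑ i ∈ F, ‖g i y‖ ^ 2) * ‖ξ y‖ ^ 2 := by
        rw [Finset.sum_mul]
        exact Finset.sum_congr rfl fun i hi => by rw [hy i hi, norm_mul, mul_pow]
    _ ≤ C * ‖ξ y‖ ^ 2 := by gcongr; exact hg F y

end Multiplication

/-! ### Compactly supported functions -/

section Cutoff

/-- A compactly supported continuous function, as an element of `C₀(Y)`. -/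
def ofCompactSupport {Y : Type*} [TopologicalSpace Y] (f : Y → ℂ) (hf : Continuous f) (hs : HasCompactSupport f) : C₀(Y, ℂ) :=
  ⟨⟨f, hf⟩, hs.is_zero_at_infty⟩

@[simp]
theorem coe_ofCompactSupport {Y : Type*} [TopologicalSpace Y] (f : Y → ℂ) (hf : Continuous f) (hs : HasCompactSupport f) :
    ⇑(ofCompactSupport f hf hs) = f := rfl

theorem hasCompactSupport_star {Y : Type*} [TopologicalSpace Y] {g : C₀(Y, ℂ)} (hg : HasCompactSupport g) :
    HasCompactSupport (star g : C₀(Y, ℂ)) :=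
  hg.comp_left (g := star) (star_zero ℂ)

variable {Y : Type*} [MetricSpace Y] [ProperSpace Y]

/-- A continuous cutoff: `1` on `{r ≤ R}`, and `0` on `{R + 1 ≤ r}`. -/
def cutoff (R r : ℝ) : ℝ := max 0 (min 1 (R + 1 - r))

theorem continuous_cutoff (R : ℝ) : Continuous (cutoff R) := by
  unfold cutoff; fun_prop

theorem cutoff_nonneg (R r : ℝ) : 0 ≤ cutoff R r := le_max_left _ _

theorem cutoff_le_one (R r : ℝ) : cutoff R r ≤ 1 := max_le zero_le_one (min_le_left _ _)

theorem cutoff_eq_one {R r : ℝ} (h : r ≤ R) : cutoff R r = 1 := by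
  rw [cutoff, min_eq_left (by linarith), max_eq_right zero_le_one]

theorem lt_of_cutoff_ne_zero {R r : ℝ} (h : cutoff R r ≠ 0) : r < R + 1 := by
  by_contra h'
  refine h (max_eq_left ((min_le_right _ _).trans ?_))
  linarith

theorem hasCompactSupport_of_dist {f : Y → ℂ} {z : Y} {R : ℝ} (h : ∀ y, f y ≠ 0 → dist y z ≤ R) :
    HasCompactSupport f :=
  HasCompactSupport.intro (isCompact_closedBall z R) fun y hy => by
    by_contra h'
    exact hy (Metric.mem_closedBall.2 (h y h'))

/-- The cutoff function of the ball of radius `R` around `z`. -/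
def ballCutoff (z : Y) (R : ℝ) : C₀(Y, ℂ) :=
  ofCompactSupport (fun y => (cutoff R (dist y z) : ℂ))
    (Complex.continuous_ofReal.comp ((continuous_cutoff R).comp (continuous_id.dist continuous_const)))
    (hasCompactSupport_of_dist (z := z) (R := R + 1) fun y hy =>
      (lt_of_cutoff_ne_zero (by simpa using hy)).le)

theorem ballCutoff_eq_one {z y : Y} {R : ℝ} (h : dist y z ≤ R) : ballCutoff z R y = 1 := by
  simp [ballCutoff, cutoff_eq_one h]

theorem hasCompactSupport_ballCutoff (z : Y) (R : ℝ) : HasCompactSupport (ballCutoff z R) :=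
  hasCompactSupport_of_dist (z := z) (R := R + 1) fun y hy =>
      (lt_of_cutoff_ne_zero (by simpa [ballCutoff] using hy)).le

end Cutoff

/-! ### Compactly supported functions separate vectors and operators -/

section Density

variable {Y : Type*} [MetricSpace Y] [ProperSpace Y] [MeasurableSpace Y] [BorelSpace Y]

/-- The cutoffs of balls of integer radius around one point exhaust `Y`; being countably many, they
leave a single null set. -/
theorem eq_zero_of_mulOp_eq_zero (μ : Measure Y) {ξ : Lp ℂ 2 μ}
    (h : ∀ g : C₀(Y, ℂ), HasCompactSupport g → mulOp μ g ξ = 0) : ξ = 0 := by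
  rcases isEmpty_or_nonempty Y with hY | ⟨⟨z⟩⟩
  · exact Lp.ext (by filter_upwards with y using hY.elim y)
  refine Lp.ext ?_
  have hall : ∀ᵐ y ∂μ, ∀ n : ℕ, ballCutoff z n y * ξ y = 0 := by
    rw [ae_all_iff]
    intro n
    filter_upwards [coeFn_mulOp μ (ballCutoff z n) ξ, Lp.coeFn_zero ℂ 2 μ] with y h1 h2
    rw [← h1, h _ (hasCompactSupport_ballCutoff z n), h2, Pi.zero_apply]
  filter_upwards [hall, Lp.coeFn_zero ℂ 2 μ] with y h1 h2
  obtain ⟨n, hn⟩ := exists_nat_ge (dist y z)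
  rw [h2, Pi.zero_apply]
  simpa [ballCutoff_eq_one hn] using h1 n

variable {μ : Measure Y} {A B : Lp ℂ 2 μ →L[ℂ] Lp ℂ 2 μ}

/-- Lets operator identities be checked after localisation, where strongly convergent block sums
become finite. -/
theorem ext_mulOp_comp
    (h : ∀ g : C₀(Y, ℂ), HasCompactSupport g → mulOp μ g ∘L A = mulOp μ g ∘L B) : A = B := by
  ext1 ξ
  rw [← sub_eq_zero]
  refine eq_zero_of_mulOp_eq_zero μ fun g hg => ?_
  rw [map_sub, sub_eq_zero]
  exact DFunLike.congr_fun (h g hg) ξ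

theorem ext_comp_mulOp
    (h : ∀ g : C₀(Y, ℂ), HasCompactSupport g → A ∘L mulOp μ g = B ∘L mulOp μ g) : A = B := by
  apply ContinuousLinearMap.adjoint.injective
  refine ext_mulOp_comp fun g hg => ?_
  have h1 := congrArg ContinuousLinearMap.adjoint (h (star g) (hasCompactSupport_star hg))
  simpa only [ContinuousLinearMap.adjoint_comp, adjoint_mulOp, star_star] using h1

end Density

/-! ### The Koopman representation is unitary and covariant -/

section KoopmanUnitary

variable {Γ : Type*} [Group Γ] {Y : Type*} [MeasurableSpace Y] [MulAction Γ Y]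
variable {μ : Measure Y} [SigmaFinite μ]

theorem inner_koopman_koopman (h : IsNonsingular Γ μ) (γ : Γ) (ξ η : Lp ℂ 2 μ) :
    ⟪koopman h γ ξ, koopman h γ η⟫_ℂ = ⟪ξ, η⟫_ℂ := by
  obtain ⟨L, hL⟩ : ∃ L : Lp ℂ 2 μ →ₗᵢ[ℂ] Lp ℂ 2 μ, koopman h γ = L.toContinuousLinearMap :=
    ⟨_, rfl⟩
  rw [hL]
  exact L.inner_map_map ξ η

theorem absolutelyContinuous_map_smul {μ : Measure Y} (h : IsNonsingular Γ μ) (γ : Γ) :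
    μ ≪ μ.map (fun y : Y => γ • y) := by
  have h1 := (h γ⁻¹).absolutelyContinuous.map (h γ).measurable
  rw [Measure.map_map (h γ).measurable (h γ⁻¹).measurable] at h1
  have : ((fun y : Y => γ • y) ∘ fun y : Y => γ⁻¹ • y) = id :=
    funext fun y => smul_inv_smul γ y
  rwa [this, Measure.map_id] at h1

/-- Pushing the pair `(μ, γ_* μ)` forward along `γ⁻¹` gives `(γ⁻¹_* μ, μ)`, so the left side is the
density of `μ` with respect to `γ_* μ` at `x`. -/
theorem rnCocycle_inv_smul (h : IsNonsingular Γ μ) (γ : Γ) :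
    ∀ᵐ x ∂μ, rnCocycle μ γ⁻¹ (γ⁻¹ • x) = (rnCocycle μ γ x)⁻¹ := by
  have hs := sigmaFinite_map_smul h γ
  let e : Y ≃ᵐ Y :=
    { toEquiv := MulAction.toPerm γ⁻¹
      measurable_toFun := (h γ⁻¹).measurable
      measurable_invFun := by
        convert (h γ).measurable using 1
        ext y
        exact inv_smul_eq_iff.1 (by simp [MulAction.toPerm]) }
  have hmm : (μ.map (fun y : Y => γ • y)).map e = μ := by
    rw [Measure.map_map e.measurable (h γ).measurable]
    have : (e ∘ fun y : Y => γ • y) = id := funext fun y => inv_smul_smul γ y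
    rw [this, Measure.map_id]
  have hac := absolutelyContinuous_map_smul h γ
  have h1 := e.measurableEmbedding.rnDeriv_map μ (μ.map (fun y : Y => γ • y))
  rw [hmm] at h1
  filter_upwards [hac.ae_le h1, Measure.inv_rnDeriv' hac] with x hx1 hx2
  exact hx1.trans hx2.symm

theorem koopman_comp_inv (h : IsNonsingular Γ μ) (γ : Γ) :
    koopman h γ ∘L koopman h γ⁻¹ = ContinuousLinearMap.id ℂ (Lp ℂ 2 μ) := by
  have hs := sigmaFinite_map_smul h γ
  have hac := absolutelyContinuous_map_smul h γ
  ext1 ξ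
  refine Lp.ext ?_
  filter_upwards [coeFn_koopman h γ (koopman h γ⁻¹ ξ),
    koopmanFun_congr h γ (coeFn_koopman h γ⁻¹ ξ), rnCocycle_inv_smul h γ,
    Measure.rnDeriv_pos' hac, (μ.map (fun y : Y => γ • y)).rnDeriv_lt_top μ] with x h1 h2 h3 h4 h5
  have hpos : 0 < (rnCocycle μ γ x).toReal := ENNReal.toReal_pos h4.ne' h5.ne
  rw [ContinuousLinearMap.comp_apply, ContinuousLinearMap.id_apply, h1, h2, koopmanFun, koopmanFun,
    h3, inv_inv, smul_inv_smul, ENNReal.toReal_inv, Real.sqrt_inv, ← mul_assoc,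
    ← Complex.ofReal_mul, mul_inv_cancel₀ (Real.sqrt_pos.2 hpos).ne', Complex.ofReal_one, one_mul]

/-- An isometry with a right inverse is unitary, and the right inverse is its adjoint. -/
theorem adjoint_koopman (h : IsNonsingular Γ μ) (γ : Γ) :
    ContinuousLinearMap.adjoint (koopman h γ) = koopman h γ⁻¹ := by
  symm
  rw [ContinuousLinearMap.eq_adjoint_iff]
  intro ξ η
  rw [← inner_koopman_koopman h γ]
  congr 1
  exact DFunLike.congr_fun (koopman_comp_inv h γ) ξ

end KoopmanUnitary

section Covariance

variable {Γ : Type*} [Group Γ] {Y : Type*} [TopologicalSpace Y] [MulAction Γ Y]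
  [ContinuousConstSMul Γ Y]

/-- The function `y ↦ f (γ y)`. -/
def translate (γ : Γ) (f : C₀(Y, ℂ)) : C₀(Y, ℂ) :=
  f.comp (Homeomorph.smul γ).toCocompactMap

theorem translate_apply (γ : Γ) (f : C₀(Y, ℂ)) (y : Y) : translate γ f y = f (γ • y) := rfl

theorem translate_inv_translate (γ : Γ) (f : C₀(Y, ℂ)) : translate γ⁻¹ (translate γ f) = f := by
  ext y
  rw [translate_apply, translate_apply, smul_inv_smul]

theorem mem_tsupport_translate {γ : Γ} {f : C₀(Y, ℂ)} {y : Y}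
    (hy : y ∈ tsupport (translate γ f)) : γ • y ∈ tsupport f :=
  tsupport_comp_subset_preimage f (f := fun y : Y => γ • y) (continuous_const_smul γ) hy

theorem hasCompactSupport_translate (γ : Γ) {f : C₀(Y, ℂ)} (hf : HasCompactSupport f) :
    HasCompactSupport (translate γ f) :=
  hf.comp_homeomorph (Homeomorph.smul γ)

variable [MeasurableSpace Y] [OpensMeasurableSpace Y] {μ : Measure Y} [SigmaFinite μ]

/-- Covariance: multiplication operators pass through `π(γ)` at the price of translating the
function. All propagation and compactness arguments for `π(γ)` rest on it. -/
theorem mulOp_comp_koopman (h : IsNonsingular Γ μ) (γ : Γ) (f : C₀(Y, ℂ)) :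
    mulOp μ f ∘L koopman h γ = koopman h γ ∘L mulOp μ (translate γ f) := by
  ext1 ξ
  refine Lp.ext ?_
  filter_upwards [coeFn_mulOp μ f (koopman h γ ξ), coeFn_koopman h γ ξ,
    coeFn_koopman h γ (mulOp μ (translate γ f) ξ),
    koopmanFun_congr h γ (coeFn_mulOp μ (translate γ f) ξ)] with y h1 h2 h3 h4
  rw [ContinuousLinearMap.comp_apply, ContinuousLinearMap.comp_apply, h1, h2, h3, h4, koopmanFun,
    koopmanFun, translate_apply, smul_inv_smul]
  ring

theorem koopman_comp_mulOp (h : IsNonsingular Γ μ) (γ : Γ) (f : C₀(Y, ℂ)) :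
    koopman h γ ∘L mulOp μ f = mulOp μ (translate γ⁻¹ f) ∘L koopman h γ := by
  rw [mulOp_comp_koopman]
  congr 2
  simpa using (translate_inv_translate γ⁻¹ f).symm

theorem isLocallyCompactOp_koopman_comp (h : IsNonsingular Γ μ) (γ : Γ)
    {T : Lp ℂ 2 μ →L[ℂ] Lp ℂ 2 μ} (hT : IsLocallyCompactOp μ T) :
    IsLocallyCompactOp μ (koopman h γ ∘L T) := by
  intro f hf
  constructor
  · rw [← ContinuousLinearMap.comp_assoc, mulOp_comp_koopman, ContinuousLinearMap.comp_assoc]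
    exact (hT _ (hasCompactSupport_translate γ hf)).1.clm_comp (koopman h γ)
  · rw [ContinuousLinearMap.comp_assoc]
    exact (hT f hf).2.clm_comp (koopman h γ)

theorem isLocallyCompactOp_comp_koopman (h : IsNonsingular Γ μ) (γ : Γ)
    {T : Lp ℂ 2 μ →L[ℂ] Lp ℂ 2 μ} (hT : IsLocallyCompactOp μ T) :
    IsLocallyCompactOp μ (T ∘L koopman h γ) := by
  intro f hf
  constructor
  · rw [← ContinuousLinearMap.comp_assoc]
    exact (hT f hf).1.comp_clm (koopman h γ)
  · rw [ContinuousLinearMap.comp_assoc, koopman_comp_mulOp, ← ContinuousLinearMap.comp_assoc]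
    exact (hT _ (hasCompactSupport_translate γ⁻¹ hf)).2.comp_clm (koopman h γ)

end Covariance

/-! ### The warped metric through chains -/

section Chains

variable {Γ : Type*} [Group Γ] {Y : Type*} [MetricSpace Y] [MulAction Γ Y]

/-- `IsChain ℓ x y t`: one gets from `x` to `y` by moves, which cost their `d`-length, and jumps
along `γ`, which cost `ℓ(γ)`, at the total cost `t`. -/
inductive IsChain (ℓ : ProperLengthFunction Γ) (x : Y) : Y → ℝ → Prop
  | refl : IsChain ℓ x x 0
  | move {y : Y} {t : ℝ} (z : Y) (h : IsChain ℓ x y t) : IsChain ℓ x z (t + dist y z)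
  | jump {y : Y} {t : ℝ} (γ : Γ) (h : IsChain ℓ x y t) : IsChain ℓ x (γ • y) (t + ℓ.len γ)

variable {ℓ : ProperLengthFunction Γ} {x y z : Y} {s t : ℝ}

theorem IsChain.of_dist (ℓ : ProperLengthFunction Γ) (x y : Y) : IsChain ℓ x y (dist x y) := by
  simpa using (IsChain.refl (ℓ := ℓ)).move (x := x) y

theorem IsChain.of_smul (ℓ : ProperLengthFunction Γ) (γ : Γ) (x : Y) :
    IsChain ℓ x (γ • x) (ℓ.len γ) := by
  simpa using (IsChain.refl (ℓ := ℓ)).jump (x := x) γ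

theorem IsChain.trans (h : IsChain ℓ x y s) (h' : IsChain ℓ y z t) : IsChain ℓ x z (s + t) := by
  induction h' with
  | refl => simpa using h
  | move z _ ih => simpa [add_assoc] using ih.move z
  | jump γ _ ih => simpa [add_assoc] using ih.jump γ

theorem IsChain.symm (h : IsChain ℓ x y t) : IsChain ℓ y x t := by
  induction h with
  | refl => exact .refl
  | @move y t z _ ih =>
    rw [add_comm, dist_comm]
    exact (IsChain.of_dist ℓ z y).trans ih
  | @jump y t γ _ ih =>
    have h1 := IsChain.of_smul ℓ γ⁻¹ (γ • y)
    rw [inv_smul_smul, ℓ.symm] at h1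
    rw [add_comm]
    exact h1.trans ih

theorem IsChain.le_of_mem_warpedCandidates (h : IsChain ℓ x y t) {ρ : Y → Y → ℝ}
    (hρ : ρ ∈ warpedCandidates Y ℓ) : ρ x y ≤ t := by
  induction h with
  | refl => exact ((hρ.1.eq_zero_iff x x).2 rfl).le
  | @move y t z _ ih => linarith [hρ.1.triangle x y z, hρ.2.1 y z]
  | @jump y t γ _ ih => linarith [hρ.1.triangle x y (γ • y), hρ.2.2 γ y]

theorem IsChain.nonneg (h : IsChain ℓ x y t) : 0 ≤ t := by
  induction h with
  | refl => exact le_rfl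
  | move z _ ih => exact add_nonneg ih dist_nonneg
  | jump γ _ ih => exact add_nonneg ih (ℓ.nonneg γ)

/-- The infimum of the costs of the chains from `x` to `y`. -/
def chainDist (ℓ : ProperLengthFunction Γ) (x y : Y) : ℝ := sInf {t | IsChain ℓ x y t}

theorem IsChain.chainDist_le (h : IsChain ℓ x y t) : chainDist ℓ x y ≤ t :=
  csInf_le ⟨0, fun _ hs => IsChain.nonneg hs⟩ h

theorem exists_isChain_lt (h : chainDist ℓ x y < t) : ∃ s < t, IsChain ℓ x y s := by
  obtain ⟨s, hs, hst⟩ := exists_lt_of_csInf_lt ⟨_, IsChain.of_dist ℓ x y⟩ h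
  exact ⟨s, hst, hs⟩

/-- Every chain cost dominates every candidate metric, hence `warpedDist`; this supplies positivity
on distinct points. The chain distance then competes in the supremum defining `warpedDist`, so cheap
chains exist between points that are close for it. -/
theorem chainDist_mem_warpedCandidates (ℓ : ProperLengthFunction Γ) :
    chainDist ℓ ∈ warpedCandidates Y ℓ := by
  have hle : ∀ x y : Y, warpedDist ℓ x y ≤ chainDist ℓ x y := fun x y =>
    le_csInf ⟨_, IsChain.of_dist ℓ x y⟩ fun t ht =>
      IsChain.le_of_mem_warpedCandidates ht (isGreatest_warpedDist ℓ).1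
  have hw := (isGreatest_warpedDist (Y := Y) ℓ).1.1
  refine ⟨⟨fun x y => ⟨fun h => ?_, ?_⟩, fun x y => ?_, fun x y z => ?_⟩,
    fun x y => (IsChain.of_dist ℓ x y).chainDist_le,
    fun γ y => (IsChain.of_smul ℓ γ y).chainDist_le⟩
  · exact (hw.eq_zero_iff x y).1 (le_antisymm ((hle x y).trans h.le) (hw.nonneg x y))
  · rintro rfl
    exact le_antisymm IsChain.refl.chainDist_le ((hw.nonneg x x).trans (hle x x))
  · exact congrArg sInf (Set.ext fun t => ⟨IsChain.symm, IsChain.symm⟩)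
  · refine le_of_forall_pos_le_add fun ε hε => ?_
    obtain ⟨s, hs, h1⟩ := exists_isChain_lt (lt_add_of_pos_right (chainDist ℓ x y) (half_pos hε))
    obtain ⟨t, ht, h2⟩ := exists_isChain_lt (lt_add_of_pos_right (chainDist ℓ y z) (half_pos hε))
    linarith [(h1.trans h2).chainDist_le]

theorem exists_isChain_of_warpedDist_lt (h : warpedDist ℓ x y < t) :
    ∃ s < t, IsChain ℓ x y s :=
  exists_isChain_lt ((le_warpedDist ℓ (chainDist_mem_warpedCandidates ℓ) x y).trans_lt h)

/-- Here `γ` is the product of the jumps and `n` counts the nontrivial ones. Each of these costs at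
least `c` and stretches the accumulated displacement by at most `L`. -/
theorem IsChain.exists_dist_smul_le {R c L : ℝ} (hL : 1 ≤ L)
    (hLip : ∀ γ : Γ, ℓ.len γ ≤ R → ∀ x y : Y, dist (γ • x) (γ • y) ≤ L * dist x y)
    (hc : ∀ γ : Γ, γ ≠ 1 → c ≤ ℓ.len γ) (h : IsChain ℓ x y t) (ht : t ≤ R) :
    ∃ (γ : Γ) (n : ℕ), ℓ.len γ ≤ t ∧ n * c ≤ t ∧ dist (γ • x) y ≤ L ^ n * t := by
  induction h with
  | refl => exact ⟨1, 0, by simp [(ℓ.eq_zero_iff 1).2 rfl]⟩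
  | @move y t z _ ih =>
    obtain ⟨γ, n, h1, h2, h3⟩ := ih (by linarith [dist_nonneg (x := y) (y := z)])
    refine ⟨γ, n, by linarith [dist_nonneg (x := y) (y := z)],
      by linarith [dist_nonneg (x := y) (y := z)], (dist_triangle _ y _).trans ?_⟩
    have := le_mul_of_one_le_left (dist_nonneg (x := y) (y := z)) (one_le_pow₀ hL (n := n))
    linarith
  | @jump y t γ' hy ih =>
    have ht0 := hy.nonneg
    have hl := ℓ.nonneg γ'
    obtain ⟨γ, n, h1, h2, h3⟩ := ih (by linarith)
    -- A trivial jump is free, so it must not be counted in `n`.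
    by_cases hγ : γ' = 1
    · subst hγ
      refine ⟨γ, n, by linarith, by linarith, ?_⟩
      rwa [one_smul, (ℓ.eq_zero_iff 1).2 rfl, add_zero]
    · refine ⟨γ' * γ, n + 1, by linarith [ℓ.subadd γ' γ], ?_, ?_⟩
      · push_cast
        linarith [hc γ' hγ]
      · rw [mul_smul]
        calc dist (γ' • γ • x) (γ' • y) ≤ L * dist (γ • x) y := hLip γ' (by linarith) _ _
          _ ≤ L * (L ^ n * t) := by gcongr
          _ = L ^ (n + 1) * t := by ring
          _ ≤ L ^ (n + 1) * (t + ℓ.len γ') := by gcongr; linarith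

theorem exists_lipschitz_const (hLip : ∀ γ : Γ, ∃ K : NNReal, LipschitzWith K (fun y : Y => γ • y))
    (S : Finset Γ) :
    ∃ L : ℝ, 1 ≤ L ∧ ∀ γ ∈ S, ∀ x y : Y, dist (γ • x) (γ • y) ≤ L * dist x y := by
  choose K hK using hLip
  refine ⟨1 + ∑ γ ∈ S, (K γ : ℝ), le_add_of_nonneg_right (by positivity), fun γ hγ x y => ?_⟩
  refine ((hK γ).dist_le_mul x y).trans ?_
  gcongr
  have := Finset.single_le_sum (f := fun γ => (K γ : ℝ)) (fun _ _ => NNReal.coe_nonneg _) hγ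
  exact this.trans (le_add_of_nonneg_left zero_le_one)

/-- Points at warped distance less than `R` are, up to one of finitely many group elements, at
bounded distance. -/
theorem exists_dist_smul_le_of_warpedDist_lt
    (hLip : ∀ γ : Γ, ∃ K : NNReal, LipschitzWith K (fun y : Y => γ • y))
    (ℓ : ProperLengthFunction Γ) (R : ℝ) :
    ∃ (S : Finset Γ) (R' : ℝ), 0 ≤ R' ∧
      ∀ x y : Y, warpedDist ℓ x y < R → ∃ γ ∈ S, dist (γ • x) y ≤ R' := by
  obtain ⟨c, hc, hc'⟩ := exists_le_len ℓ
  obtain ⟨L, hL, hL'⟩ := exists_lipschitz_const hLip (ℓ.proper R).toFinset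
  -- A chain of cost below `R` has at most `R / c` nontrivial jumps. The `max` keeps the bound
  -- nonnegative for negative `R`.
  refine ⟨(ℓ.proper R).toFinset, L ^ ⌊R / c⌋₊ * max R 0, by positivity, fun x y hxy => ?_⟩
  obtain ⟨t, ht, hch⟩ := exists_isChain_of_warpedDist_lt hxy
  obtain ⟨γ, n, h1, h2, h3⟩ := hch.exists_dist_smul_le hL
    (fun γ hγ => hL' γ (by simpa using hγ)) hc' ht.le
  refine ⟨γ, by simpa using h1.trans ht.le, h3.trans ?_⟩
  have hn : n ≤ ⌊R / c⌋₊ := Nat.le_floor ((le_div_iff₀ hc).2 (h2.trans ht.le))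
  have := hch.nonneg
  have := ht.le.trans (le_max_left R 0)
  gcongr

theorem continuous_warpedDist (ℓ : ProperLengthFunction Γ) (x : Y) :
    Continuous (warpedDist ℓ x) := by
  have hw := (isGreatest_warpedDist (Y := Y) ℓ).1
  refine (LipschitzWith.of_le_add fun y z => ?_).continuous
  have := hw.1.triangle x z y
  have := hw.2.1 z y
  rw [dist_comm] at this
  linarith

end Chains

/-! ### Bounded geometry -/

section BoundedGeometry

variable {Y : Type*} [MetricSpace Y]

theorem exists_maximal_separated (Y : Type*) [MetricSpace Y] {r : ℝ} (hr : 0 < r) :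
    ∃ s : Set Y, (∀ x ∈ s, ∀ y ∈ s, x ≠ y → r ≤ dist x y) ∧ ∀ y, ∃ x ∈ s, dist y x < r := by
  obtain ⟨s, hs⟩ := zorn_subset {s : Set Y | s.Pairwise fun x y => r ≤ dist x y}
    fun c hc hcc => ⟨⋃₀ c, (Set.pairwise_sUnion hcc.directedOn).2 hc,
      fun _ => Set.subset_sUnion_of_mem⟩
  refine ⟨s, hs.prop, fun y => ?_⟩
  by_contra! h
  have hy : insert y s ∈ {s : Set Y | s.Pairwise fun x y => r ≤ dist x y} := by
    refine hs.prop.insert fun x hx _ => ⟨h x hx, ?_⟩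
    rw [dist_comm]
    exact h x hx
  have := h y (hs.le_of_ge hy (Set.subset_insert y s) (Set.mem_insert y s))
  rw [dist_self] at this
  linarith

/-- Every ball contains boundedly many points of `s`. -/
def IsUniformlyDiscrete (s : Set Y) : Prop :=
  ∀ R : ℝ, ∃ N : ℕ, ∀ y : Y, ∃ G : Finset s, G.card ≤ N ∧ ∀ i : s, dist y i < R → i ∈ G

theorem IsUniformlyDiscrete.exists_finset_of_isCompact {s : Set Y} (hs : IsUniformlyDiscrete s)
    {K : Set Y} (hK : IsCompact K) (R : ℝ) :
    ∃ F : Finset s, ∀ y ∈ K, ∀ i : s, dist y i < R → i ∈ F := by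
  rcases K.eq_empty_or_nonempty with rfl | ⟨z, -⟩
  · exact ⟨∅, by simp⟩
  obtain ⟨ρ, hρ⟩ := hK.isBounded.subset_ball z
  obtain ⟨N, hN⟩ := hs (ρ + R)
  obtain ⟨F, -, hF⟩ := hN z
  refine ⟨F, fun y hy i hi => hF i ?_⟩
  have := Metric.mem_ball'.1 (hρ hy)
  linarith [dist_triangle z y i]

/-- In a space of bounded geometry there is a net whose balls have uniformly bounded
cardinality. -/
theorem HasBoundedGeometry.exists_net (h : HasBoundedGeometry Y) :
    ∃ (s : Set Y) (r : ℝ), 0 < r ∧ (∀ y, ∃ x ∈ s, dist y x < r) ∧ IsUniformlyDiscrete s := by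
  obtain ⟨ϱ, hϱ, h⟩ := h
  -- With separation `2 * ϱ`, a ball of radius `ϱ` contains at most one point of the net, so
  -- counting covering balls counts net points.
  obtain ⟨s, hs, hs'⟩ := exists_maximal_separated Y (r := 2 * ϱ) (by positivity)
  refine ⟨s, 2 * ϱ, by positivity, hs', fun R => ?_⟩
  obtain ⟨N, hN⟩ := h (max R 1) (by positivity)
  refine ⟨N, fun y => ?_⟩
  obtain ⟨F, hF, hcov⟩ := hN y
  have hex : ∀ i : s, dist y i < R → ∃ z ∈ F, dist (i : Y) z < ϱ := fun i hi => by
    have : (i : Y) ∈ Metric.ball y (max R 1) :=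
      Metric.mem_ball'.2 (hi.trans_le (le_max_left _ _))
    simpa using hcov this
  have : Nonempty Y := ⟨y⟩
  choose! g hg hg' using hex
  have hinj : Set.InjOn g {i : s | dist y i < R} := fun i hi j hj hij => by
    by_contra hne
    have h1 := hs i i.2 j j.2 (fun h => hne (Subtype.ext h))
    have h2 := hg' i hi
    have h3 := hg' j hj
    rw [← hij] at h3
    linarith [dist_triangle_right (i : Y) j (g i)]
  have hmaps : Set.MapsTo g {i : s | dist y i < R} F := fun i hi => hg i hi
  have hfin : {i : s | dist y i < R}.Finite := Set.Finite.of_injOn hmaps hinj F.finite_toSet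
  refine ⟨hfin.toFinset, ?_, fun i hi => by simpa using hi⟩
  refine (Finset.card_le_card_of_injOn g (fun i hi => hmaps (by simpa using hi)) ?_).trans hF
  simpa using hinj

end BoundedGeometry

/-! ### Partitions of unity and weights -/

section Weights

variable {Y : Type*} [MetricSpace Y] [ProperSpace Y]

/-- Since `0 ≤ u i ≤ 1`, the sum of squares is at most the sum, so an ordinary partition of unity is
already square-summable. -/
theorem exists_partition_of_net {s : Set Y} {r : ℝ} (hs : ∀ y, ∃ x ∈ s, dist y x < r) :
    ∃ u : s → C₀(Y, ℂ), (∀ i, star (u i) = u i) ∧ (∀ i, tsupport (u i) ⊆ Metric.closedBall i r) ∧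
      (∀ i y, u i y ≠ 0 → dist y i < r) ∧
      (∀ (F : Finset s) y, ∑ i ∈ F, ‖u i y‖ ^ 2 ≤ 1) ∧
      ∀ (F : Finset s) y, (∀ i, u i y ≠ 0 → i ∈ F) → ∑ i ∈ F, u i y = 1 := by
  classical
  obtain ⟨p, hp⟩ := PartitionOfUnity.exists_isSubordinate (X := Y) isClosed_univ
    (fun i : s => Metric.ball (i : Y) r) (fun i => Metric.isOpen_ball) fun y _ => by
      obtain ⟨x, hx, hxy⟩ := hs y
      exact Set.mem_iUnion.2 ⟨⟨x, hx⟩, hxy⟩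
  have hsupp : ∀ i y, ((p i y : ℝ) : ℂ) ≠ 0 → dist y i < r := fun i y hy =>
    hp i (subset_tsupport _ (by simpa using hy))
  have hcs : ∀ i, HasCompactSupport fun y => ((p i y : ℝ) : ℂ) := fun i =>
    hasCompactSupport_of_dist (z := (i : Y)) (R := r) fun y hy => (hsupp i y hy).le
  have hfin : ∀ y, (Function.support fun i => p i y).Finite := fun y =>
    p.locallyFinite.point_finite y
  refine ⟨fun i => ofCompactSupport _ (Complex.continuous_ofReal.comp (p i).continuous) (hcs i),
    fun i => ?_, fun i => ?_, hsupp, fun F y => ?_, fun F y hF => ?_⟩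
  · ext y
    simp
  · exact closure_minimal (fun y hy => (hsupp i y hy).le) Metric.isClosed_closedBall
  · calc ∑ i ∈ F, ‖((p i y : ℝ) : ℂ)‖ ^ 2 ≤ ∑ i ∈ F, p i y := by
          refine Finset.sum_le_sum fun i _ => ?_
          rw [Complex.norm_real, Real.norm_of_nonneg (p.nonneg i y)]
          exact pow_le_of_le_one (p.nonneg i y) (p.le_one i y) two_ne_zero
      _ ≤ ∑ᶠ i, p i y := by
          rw [finsum_eq_sum_of_support_subset (s := (hfin y).toFinset ∪ F) _ (by simp)]
          exact Finset.sum_le_sum_of_subset_of_nonneg Finset.subset_union_right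
            fun i _ _ => p.nonneg i y
      _ = 1 := p.sum_eq_one (Set.mem_univ y)
  · have h1 : ∑ i ∈ F, p i y = 1 := by
      rw [← p.sum_eq_one (Set.mem_univ y)]
      refine (finsum_eq_sum_of_support_subset _ fun i hi => hF i ?_).symm
      simpa using hi
    change ∑ i ∈ F, ((p i y : ℝ) : ℂ) = 1
    exact_mod_cast h1

end Weights

section Weights

variable {Y : Type*} [MetricSpace Y]
variable {Γ : Type*} [Group Γ] [MulAction Γ Y] [ContinuousConstSMul Γ Y]

/-- The unnormalised weight: the total of the cutoffs of the `γ⁻¹`-translates of a ball. -/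
def weightSum (S : Finset Γ) (R : ℝ) (b y : Y) : ℝ := ∑ γ ∈ S, cutoff R (dist (γ • y) b)

theorem continuous_cutoff_smul (γ : Γ) (R : ℝ) (b : Y) :
    Continuous fun y : Y => cutoff R (dist (γ • y) b) :=
  (continuous_cutoff R).comp ((continuous_const_smul γ).dist continuous_const)

theorem continuous_weightSum (S : Finset Γ) (R : ℝ) (b : Y) : Continuous (weightSum S R b) :=
  continuous_finsetSum _ fun γ _ => continuous_cutoff_smul γ R b

variable [ProperSpace Y]

/-- The weights: continuous functions supported near the `γ⁻¹`-translates of the ball of radius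
`R` around `b`, for `γ ∈ S`, which sum to `1` on the union of these translates. -/
def weight (S : Finset Γ) (R : ℝ) (b : Y) (γ : Γ) : C₀(Y, ℂ) :=
  -- The `max` keeps the denominator positive everywhere, and leaves it equal to `weightSum`
  -- wherever some cutoff equals `1`.
  ofCompactSupport (fun y => ((cutoff R (dist (γ • y) b) / max 1 (weightSum S R b y) : ℝ) : ℂ))
    (Complex.continuous_ofReal.comp ((continuous_cutoff_smul γ R b).div
      (continuous_const.max (continuous_weightSum S R b))
      fun _ => (lt_max_of_lt_left one_pos).ne'))
    ((hasCompactSupport_translate γ (hasCompactSupport_ballCutoff b R)).mono fun y hy => by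
      have hy' : cutoff R (dist (γ • y) b) ≠ 0 := fun h => hy (by simp [h])
      simpa [translate_apply, ballCutoff] using hy')

variable {S : Finset Γ} {R : ℝ} {b y : Y} {γ : Γ}

theorem dist_lt_of_weight_ne_zero (h : weight S R b γ y ≠ 0) : dist (γ • y) b < R + 1 :=
  lt_of_cutoff_ne_zero fun h' => h (by simp [weight, h'])

theorem norm_weight_le_one : ‖weight S R b γ y‖ ≤ 1 := by
  by_cases h : weight S R b γ y = 0
  · simp [h]
  have : weight S R b γ y
    = ((cutoff R (dist (γ • y) b) / max 1 (weightSum S R b y) : ℝ) : ℂ) := rfl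
  rw [this, Complex.norm_real, Real.norm_of_nonneg
    (div_nonneg (cutoff_nonneg _ _) (zero_le_one.trans (le_max_left _ _)))]
  exact div_le_one_of_le₀ ((cutoff_le_one _ _).trans (le_max_left _ _))
    (zero_le_one.trans (le_max_left _ _))

theorem sum_weight_eq_one (h : ∃ γ ∈ S, dist (γ • y) b ≤ R) : ∑ γ ∈ S, weight S R b γ y = 1 := by
  obtain ⟨γ, hγ, hd⟩ := h
  have h1 : 1 ≤ weightSum S R b y := by
    rw [← cutoff_eq_one hd]
    exact Finset.single_le_sum (f := fun γ => cutoff R (dist (γ • y) b))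
      (fun _ _ => cutoff_nonneg _ _) hγ
  have h2 : ∑ γ ∈ S, cutoff R (dist (γ • y) b) / max 1 (weightSum S R b y) = 1 := by
    rw [← Finset.sum_div, max_eq_right h1]
    exact div_self (zero_lt_one.trans_le h1).ne'
  change ∑ γ ∈ S, ((cutoff R (dist (γ • y) b) / max 1 (weightSum S R b y) : ℝ) : ℂ) = 1
  exact_mod_cast h2

/-- Only net points within `R + 1` of `γ • y` contribute, each by at most `1`. This is where bounded
geometry bounds the overlap. -/
theorem IsUniformlyDiscrete.exists_sum_weight_le {s : Set Y} (hs : IsUniformlyDiscrete s)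
    (S : Finset Γ) (R : ℝ) : ∃ N : ℕ, ∀ (γ : Γ) (F : Finset s) (y : Y),
      ∑ i ∈ F, ‖weight S R (i : Y) γ y‖ ^ 2 ≤ N := by
  classical
  obtain ⟨N, hN⟩ := hs (R + 1)
  refine ⟨N, fun γ F y => ?_⟩
  obtain ⟨G, hG, hG'⟩ := hN (γ • y)
  calc ∑ i ∈ F, ‖weight S R (i : Y) γ y‖ ^ 2 ≤ ∑ i ∈ F, if i ∈ G then (1 : ℝ) else 0 := by
        refine Finset.sum_le_sum fun i _ => ?_
        split_ifs with hi
        · exact pow_le_one₀ (norm_nonneg _) norm_weight_le_one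
        · have : weight S R (i : Y) γ y = 0 := by
            by_contra h
            exact hi (hG' i (dist_lt_of_weight_ne_zero h))
          simp [this]
    _ = ((F.filter (· ∈ G)).card : ℝ) := by rw [Finset.sum_boole]
    _ ≤ N := by
        exact_mod_cast (Finset.card_le_card fun i hi => (Finset.mem_filter.1 hi).2).trans hG

end Weights

/-! ### Block sums of operators -/

section BlockSum

variable {Y : Type*} [TopologicalSpace Y] [MeasurableSpace Y] [OpensMeasurableSpace Y]
variable {μ : Measure Y} {ι : Type*}

/-- `T'` is the strongly convergent sum of the operators `M_{u i} T M_{w i}`. -/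
def IsBlockSum (μ : Measure Y) (u w : ι → C₀(Y, ℂ)) (T T' : Lp ℂ 2 μ →L[ℂ] Lp ℂ 2 μ) : Prop :=
  ∀ ξ, HasSum (fun i => mulOp μ (u i) (T (mulOp μ (w i) ξ))) (T' ξ)

/-- The row of the self-adjoint `M_{u i}` is multiplied with the column of the `T M_{w i}`. -/
theorem exists_isBlockSum {u w : ι → C₀(Y, ℂ)} {C D : ℝ} (hC : 0 ≤ C) (hD : 0 ≤ D)
    (hu : ∀ i, star (u i) = u i) (hu' : ∀ (F : Finset ι) y, ∑ i ∈ F, ‖u i y‖ ^ 2 ≤ C)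
    (hw : ∀ (F : Finset ι) y, ∑ i ∈ F, ‖w i y‖ ^ 2 ≤ D) (T : Lp ℂ 2 μ →L[ℂ] Lp ℂ 2 μ) :
    ∃ T', IsBlockSum μ u w T T' := by
  have hw' : IsSqSummable (fun i => T ∘L mulOp μ (w i)) (‖T‖ ^ 2 * D) := fun F ξ => by
    calc ∑ i ∈ F, ‖T (mulOp μ (w i) ξ)‖ ^ 2 ≤ ∑ i ∈ F, ‖T‖ ^ 2 * ‖mulOp μ (w i) ξ‖ ^ 2 := by
          refine Finset.sum_le_sum fun i _ => ?_
          rw [← mul_pow]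
          gcongr
          exact T.le_opNorm _
      _ ≤ ‖T‖ ^ 2 * (D * ‖ξ‖ ^ 2) := by
          rw [← Finset.mul_sum]
          gcongr
          exact sum_norm_sq_mulOp_le μ hw F ξ
      _ = ‖T‖ ^ 2 * D * ‖ξ‖ ^ 2 := by ring
  obtain ⟨T', hT'⟩ := exists_hasSum_adjoint_comp hC (by positivity)
    (sum_norm_sq_mulOp_le μ hu') hw'
  refine ⟨T', fun ξ => ?_⟩
  have := hT' ξ
  simp only [adjoint_mulOp, hu] at this
  exact this

variable {u w : ι → C₀(Y, ℂ)} {T T' : Lp ℂ 2 μ →L[ℂ] Lp ℂ 2 μ}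

theorem IsBlockSum.mulOp_comp (h : IsBlockSum μ u w T T') {g : C₀(Y, ℂ)} {F : Finset ι}
    (hF : ∀ i ∉ F, g * u i = 0) :
    mulOp μ g ∘L T' = ∑ i ∈ F, mulOp μ (g * u i) ∘L T ∘L mulOp μ (w i) := by
  ext1 ξ
  have h1 := (h ξ).mapL (mulOp μ g)
  have h2 : ∀ i, mulOp μ g (mulOp μ (u i) (T (mulOp μ (w i) ξ))) =
      (mulOp μ (g * u i) ∘L T ∘L mulOp μ (w i)) ξ := fun i => by rw [mulOp_mul]; rfl
  simp only [h2] at h1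
  rw [_root_.sum_apply]
  refine h1.unique (hasSum_sum_of_ne_finset_zero fun i hi => ?_)
  rw [hF i hi, mulOp_zero]
  rfl

theorem IsBlockSum.comp_mulOp (h : IsBlockSum μ u w T T') {g : C₀(Y, ℂ)} {F : Finset ι}
    (hF : ∀ i ∉ F, w i * g = 0) :
    T' ∘L mulOp μ g = ∑ i ∈ F, mulOp μ (u i) ∘L T ∘L mulOp μ (w i * g) := by
  ext1 ξ
  have h1 := h (mulOp μ g ξ)
  have h2 : ∀ i, mulOp μ (u i) (T (mulOp μ (w i) (mulOp μ g ξ))) =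
      (mulOp μ (u i) ∘L T ∘L mulOp μ (w i * g)) ξ := fun i => by rw [mulOp_mul]; rfl
  simp only [h2] at h1
  rw [_root_.sum_apply]
  refine h1.unique (hasSum_sum_of_ne_finset_zero fun i hi => ?_)
  rw [hF i hi, mulOp_zero]
  simp

theorem IsBlockSum.mulOp_comp_mulOp_eq_zero (h : IsBlockSum μ u w T T') {f g : C₀(Y, ℂ)}
    (hfg : ∀ i, f * u i = 0 ∨ w i * g = 0) : mulOp μ f ∘L T' ∘L mulOp μ g = 0 := by
  ext1 ξ
  have h1 := (h (mulOp μ g ξ)).mapL (mulOp μ f)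
  refine h1.unique ?_
  rw [_root_.zero_apply]
  convert hasSum_zero using 2 with i
  have h2 : mulOp μ f (mulOp μ (u i) (T (mulOp μ (w i) (mulOp μ g ξ)))) =
      (mulOp μ (f * u i) ∘L T ∘L mulOp μ (w i * g)) ξ := by rw [mulOp_mul, mulOp_mul]; rfl
  rw [h2]
  rcases hfg i with h3 | h3 <;> simp [h3, mulOp_zero]

theorem isCompactOperator_sum {E : Type*} [NormedAddCommGroup E] [NormedSpace ℂ E]
    {A : ι → E →L[ℂ] E} {F : Finset ι} (h : ∀ i ∈ F, IsCompactOperator (A i)) :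
    IsCompactOperator (∑ i ∈ F, A i : E →L[ℂ] E) := by
  exact sum_mem (S := compactOperator (RingHom.id ℂ) E E) h

/-- A block sum of a locally compact operator is locally compact, if compact sets meet the supports
of only finitely many functions of each family. -/
theorem IsBlockSum.isLocallyCompactOp (h : IsBlockSum μ u w T T')
    (hu : ∀ g : C₀(Y, ℂ), HasCompactSupport g → ∃ F : Finset ι, ∀ i ∉ F, g * u i = 0)
    (hw : ∀ g : C₀(Y, ℂ), HasCompactSupport g → ∃ F : Finset ι, ∀ i ∉ F, w i * g = 0)
    (hT : IsLocallyCompactOp μ T) : IsLocallyCompactOp μ T' := by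
  intro g hg
  constructor
  · obtain ⟨F, hF⟩ := hu g hg
    rw [h.mulOp_comp hF]
    refine isCompactOperator_sum fun i _ => ?_
    rw [← ContinuousLinearMap.comp_assoc]
    refine IsCompactOperator.comp_clm (hT _ ?_).1 (mulOp μ (w i))
    exact HasCompactSupport.mul_right hg
  · obtain ⟨F, hF⟩ := hw g hg
    rw [h.comp_mulOp hF]
    refine isCompactOperator_sum fun i _ => ?_
    refine IsCompactOperator.clm_comp (hT _ ?_).2 (mulOp μ (u i))
    exact HasCompactSupport.mul_left hg

end BlockSum

/-! ### Decomposition of operators of finite propagation for the warped metric -/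

section Decomposition

theorem mul_eq_zero_of_forall {Y : Type*} [TopologicalSpace Y] {f g : C₀(Y, ℂ)} (h : ∀ y, f y ≠ 0 → g y = 0) : f * g = 0 := by
  ext y
  by_cases hy : f y = 0 <;> simp [hy, h y]

variable {Γ : Type*} [Group Γ] {Y : Type*} [MetricSpace Y] [ProperSpace Y] [MeasurableSpace Y]
  [BorelSpace Y] [MulAction Γ Y] [ContinuousConstSMul Γ Y] {μ : Measure Y}

/-- Where the weights do not sum to `1`, the warped distance to `b` is at least `R + r + 1`, too far
from the support of `u` for `T` to connect the two. -/
theorem HasPropagationLE.comp_sum_weight {ℓ : ProperLengthFunction Γ} {R : ℝ}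
    {T : Lp ℂ 2 μ →L[ℂ] Lp ℂ 2 μ} (hT : HasPropagationLE (warpedDist ℓ) μ T R) {u : C₀(Y, ℂ)}
    {b : Y} {r : ℝ} (hu : tsupport u ⊆ Metric.closedBall b r) {S : Finset Γ} {R' : ℝ}
    (hS : ∀ y, warpedDist ℓ y b < R + r + 1 → ∃ γ ∈ S, dist (γ • y) b ≤ R') :
    mulOp μ u ∘L T ∘L (∑ γ ∈ S, mulOp μ (weight S R' b γ)) = mulOp μ u ∘L T := by
  have hw := (isGreatest_warpedDist (Y := Y) ℓ).1
  -- The constant `1` need not lie in `C₀(Y)`, so `1 - ∑ γ, w γ` is first multiplied by `g`.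
  refine ext_comp_mulOp fun g _ => ?_
  have hsub : tsupport (g - ∑ γ ∈ S, weight S R' b γ * g : C₀(Y, ℂ)) ⊆
      {y | R + r + 1 ≤ warpedDist ℓ b y} := by
    refine closure_minimal (fun y hy => ?_)
      (isClosed_le continuous_const (continuous_warpedDist ℓ b))
    by_contra hlt
    refine hy ?_
    have h1 := hS y (by rw [hw.1.symm]; exact not_le.1 hlt)
    have h2 : (∑ γ ∈ S, weight S R' b γ * g : C₀(Y, ℂ)) y = ∑ γ ∈ S, weight S R' b γ y * g y :=
      map_sum (⟨⟨fun f : C₀(Y, ℂ) => f y, rfl⟩, fun _ _ => rfl⟩ : C₀(Y, ℂ) →+ ℂ) _ _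
    rw [ZeroAtInftyContinuousMap.sub_apply, h2, ← Finset.sum_mul, sum_weight_eq_one h1, one_mul,
      sub_self]
  -- The extra `1` in `hS` provides the strict separation that `SetDistGT` demands.
  have h0 := hT u (g - ∑ γ ∈ S, weight S R' b γ * g) ⟨R + 1, by linarith, fun x hx y hy => by
    have h1 := hw.1.triangle b x y
    have h2 := hw.2.1 b x
    have h3 : dist x b ≤ r := hu hx
    have h4 : R + r + 1 ≤ warpedDist ℓ b y := hsub hy
    rw [dist_comm] at h3
    linarith⟩
  rw [mulOp_sub, mulOp_sum, ContinuousLinearMap.comp_sub, ContinuousLinearMap.comp_sub,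
    sub_eq_zero] at h0
  simp only [mulOp_mul] at h0
  rw [← ContinuousLinearMap.finsetSum_comp] at h0
  simp only [ContinuousLinearMap.comp_assoc]
  exact h0.symm

variable [SigmaFinite μ]

/-- Each block goes from near `γ⁻¹ B(b i, R)` to near `b i`, and `π(γ⁻¹)` moves the target back next
to the source. The displacement `R + 1 + r` is stretched by the Lipschitz constant of `γ⁻¹`. -/
theorem IsBlockSum.koopman_comp_mem_fpStar (hns : IsNonsingular Γ μ)
    (hLip : ∀ γ : Γ, ∃ K : NNReal, LipschitzWith K (fun y : Y => γ • y)) {ι : Type*} {b : ι → Y}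
    {u : ι → C₀(Y, ℂ)} {r : ℝ} (hr : 0 ≤ r) (hu : ∀ i y, u i y ≠ 0 → dist y (b i) < r)
    {S : Finset Γ} {R : ℝ} (hR : 0 ≤ R) {γ : Γ} {T T' : Lp ℂ 2 μ →L[ℂ] Lp ℂ 2 μ}
    (h : IsBlockSum μ u (fun i => weight S R (b i) γ) T T') :
    koopman hns γ⁻¹ ∘L T' ∈ fpStar (dist : Y → Y → ℝ) μ := by
  obtain ⟨K, hK⟩ := hLip γ⁻¹
  refine ⟨K * (R + 1 + r), by positivity, fun f g ⟨t, ht, hfg⟩ => ?_⟩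
  rw [← ContinuousLinearMap.comp_assoc, ← ContinuousLinearMap.comp_assoc, mulOp_comp_koopman,
    ContinuousLinearMap.comp_assoc, ContinuousLinearMap.comp_assoc, h.mulOp_comp_mulOp_eq_zero,
    ContinuousLinearMap.comp_zero]
  intro i
  by_contra! hne
  obtain ⟨x, hx⟩ := DFunLike.ne_iff.1 hne.1
  obtain ⟨y, hy⟩ := DFunLike.ne_iff.1 hne.2
  rw [ZeroAtInftyContinuousMap.mul_apply] at hx hy
  have hfx : f (γ⁻¹ • x) ≠ 0 := left_ne_zero_of_mul hx
  have hux := hu i x (right_ne_zero_of_mul hx)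
  have hwy := dist_lt_of_weight_ne_zero (left_ne_zero_of_mul hy)
  have h1 := hfg _ (subset_tsupport _ hfx) y (subset_tsupport _ (right_ne_zero_of_mul hy))
  have h2 := hK.dist_le_mul x (γ • y)
  simp only [inv_smul_smul] at h2
  have h3 : (K : ℝ) * dist x (γ • y) ≤ K * (R + 1 + r) := by
    gcongr
    linarith [dist_triangle_right x (γ • y) (b i)]
  linarith

/-- Local compactness enters as an implication, so that one decomposition serves both the finite
propagation and the Roe algebras. -/
theorem exists_decomposition (hns : IsNonsingular Γ μ)
    (hLip : ∀ γ : Γ, ∃ K : NNReal, LipschitzWith K (fun y : Y => γ • y))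
    (hbg : HasBoundedGeometry Y) (ℓ : ProperLengthFunction Γ) {T : Lp ℂ 2 μ →L[ℂ] Lp ℂ 2 μ}
    (hT : T ∈ fpStar (warpedDist ℓ) μ) :
    ∃ (S : Finset Γ) (T' : Γ → Lp ℂ 2 μ →L[ℂ] Lp ℂ 2 μ), T = ∑ γ ∈ S, T' γ ∧
      ∀ γ, koopman hns γ⁻¹ ∘L T' γ ∈ fpStar (dist : Y → Y → ℝ) μ ∧
        (IsLocallyCompactOp μ T → IsLocallyCompactOp μ (T' γ)) := by
  obtain ⟨R, -, hT⟩ := hT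
  obtain ⟨s, r, hr, hcov, hs⟩ := hbg.exists_net
  obtain ⟨u, hu_star, hu_supp, hu_dist, hu_sq, hu_sum⟩ := exists_partition_of_net hcov
  obtain ⟨S, R', hR', hS⟩ := exists_dist_smul_le_of_warpedDist_lt hLip ℓ (R + r + 1)
  obtain ⟨N, hN⟩ := hs.exists_sum_weight_le S R'
  have hF : ∀ g : C₀(Y, ℂ), HasCompactSupport g → ∃ F : Finset s,
      ∀ i : s, i ∉ F → g * u i = 0 := fun g hg => by
    obtain ⟨F, hF⟩ := hs.exists_finset_of_isCompact hg r
    refine ⟨F, fun i hi => mul_eq_zero_of_forall fun y hy => ?_⟩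
    by_contra h
    exact hi (hF y (subset_tsupport _ hy) i (hu_dist i y h))
  have hF' : ∀ (γ : Γ) (g : C₀(Y, ℂ)), HasCompactSupport g → ∃ F : Finset s,
      ∀ i : s, i ∉ F → weight S R' (i : Y) γ * g = 0 := fun γ g hg => by
    obtain ⟨F, hF⟩ := hs.exists_finset_of_isCompact (hg.isCompact.image (continuous_const_smul γ))
      (R' + 1)
    refine ⟨F, fun i hi => mul_eq_zero_of_forall fun y hy => ?_⟩
    by_contra h
    exact hi (hF (γ • y) ⟨y, subset_tsupport _ h, rfl⟩ i (dist_lt_of_weight_ne_zero hy))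
  choose T' hT' using fun γ : Γ => exists_isBlockSum (μ := μ) zero_le_one (Nat.cast_nonneg N)
    hu_star hu_sq (hN γ) T
  refine ⟨S, T', ?_, fun γ => ⟨(hT' γ).koopman_comp_mem_fpStar hns hLip hr.le hu_dist hR',
    (hT' γ).isLocallyCompactOp hF (hF' γ)⟩⟩
  -- After multiplication by `g` only finitely many blocks remain, and the sums over `i` and `γ` may
  -- be exchanged.
  refine ext_mulOp_comp fun g hg => ?_
  obtain ⟨F, hF⟩ := hF g hg
  have hgu : ∑ i ∈ F, g * u i = g := by
    ext y
    have h2 : (∑ i ∈ F, g * u i : C₀(Y, ℂ)) y = ∑ i ∈ F, g y * u i y :=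
      map_sum (⟨⟨fun f : C₀(Y, ℂ) => f y, rfl⟩, fun _ _ => rfl⟩ : C₀(Y, ℂ) →+ ℂ) _ _
    rw [h2, ← Finset.mul_sum]
    by_cases hy : g y = 0
    · rw [hy, zero_mul]
    rw [hu_sum F y, mul_one]
    intro i hi
    by_contra hiF
    have := DFunLike.congr_fun (hF i hiF) y
    exact mul_ne_zero hy hi this
  calc mulOp μ g ∘L T = ∑ i ∈ F, mulOp μ (g * u i) ∘L T := by
        rw [← ContinuousLinearMap.finsetSum_comp, ← mulOp_sum, hgu]
    _ = ∑ i ∈ F, ∑ γ ∈ S, mulOp μ (g * u i) ∘L T ∘L mulOp μ (weight S R' (i : Y) γ) := by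
        refine Finset.sum_congr rfl fun i _ => ?_
        have h1 := hT.comp_sum_weight (hu_supp i) fun y hy => hS y i hy
        rw [mulOp_mul, ContinuousLinearMap.comp_assoc, ← h1]
        simp only [ContinuousLinearMap.comp_finsetSum, ContinuousLinearMap.comp_assoc]
    _ = mulOp μ g ∘L ∑ γ ∈ S, T' γ := by
        rw [Finset.sum_comm, ContinuousLinearMap.comp_finsetSum]
        exact Finset.sum_congr rfl fun γ _ => ((hT' γ).mulOp_comp hF).symm

end Decomposition

/-! ### Normalization and spans -/

section Span

variable {Γ : Type*} [Group Γ] {Y : Type*} [MeasurableSpace Y] [MulAction Γ Y]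
  {μ : Measure Y} [SigmaFinite μ]

theorem Normalizes.topologicalClosure {h : IsNonsingular Γ μ}
    {B : Submodule ℂ (Lp ℂ 2 μ →L[ℂ] Lp ℂ 2 μ)} (hB : Normalizes h B) :
    Normalizes h B.topologicalClosure := fun γ _ hb =>
  map_mem_closure (f := fun b => koopman h γ ∘L b ∘L ContinuousLinearMap.adjoint (koopman h γ))
    (continuous_const.clm_comp (continuous_id.clm_comp continuous_const)) hb
    fun b hb => hB γ b hb

/-- Left multiplication by `π(γ)` is continuous, so it maps the closure of `B` into the closure of
`Γ · B`. -/
theorem topologicalClosure_groupSpan (h : IsNonsingular Γ μ)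
    (B : Submodule ℂ (Lp ℂ 2 μ →L[ℂ] Lp ℂ 2 μ)) :
    (groupSpan h B).topologicalClosure = (groupSpan h B.topologicalClosure).topologicalClosure := by
  refine le_antisymm (Submodule.topologicalClosure_mono (Submodule.span_mono ?_))
    (Submodule.topologicalClosure_minimal _ (Submodule.span_le.2 ?_)
      (Submodule.isClosed_topologicalClosure _))
  · rintro _ ⟨γ, b, hb, rfl⟩
    exact ⟨γ, b, B.le_topologicalClosure hb, rfl⟩
  · rintro _ ⟨γ, b, hb, rfl⟩
    exact map_mem_closure (continuous_const.clm_comp continuous_id) hb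
      fun b hb => Submodule.subset_span ⟨γ, b, hb, rfl⟩

theorem sum_mem_groupSpan (hns : IsNonsingular Γ μ)
    {B : Submodule ℂ (Lp ℂ 2 μ →L[ℂ] Lp ℂ 2 μ)} {S : Finset Γ}
    {T : Γ → Lp ℂ 2 μ →L[ℂ] Lp ℂ 2 μ} (hT : ∀ γ, koopman hns γ⁻¹ ∘L T γ ∈ B) :
    ∑ γ ∈ S, T γ ∈ groupSpan hns B := by
  refine sum_mem fun γ _ => Submodule.subset_span ⟨γ, _, hT γ, ?_⟩
  rw [← ContinuousLinearMap.comp_assoc, koopman_comp_inv, ContinuousLinearMap.id_comp]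

end Span

/-! ### The two inclusions and normalization -/

section Main

variable {Γ : Type*} [Group Γ] {Y : Type*} [MetricSpace Y] [MeasurableSpace Y]
  [BorelSpace Y] [MulAction Γ Y] [ContinuousConstSMul Γ Y] {μ : Measure Y} [SigmaFinite μ]

theorem koopman_comp_mem_fpStar_warpedDist (hns : IsNonsingular Γ μ) (ℓ : ProperLengthFunction Γ)
    (γ : Γ) {T : Lp ℂ 2 μ →L[ℂ] Lp ℂ 2 μ} (hT : T ∈ fpStar (dist : Y → Y → ℝ) μ) :
    koopman hns γ ∘L T ∈ fpStar (warpedDist ℓ) μ := by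
  obtain ⟨R, hR, hT⟩ := hT
  have hw := (isGreatest_warpedDist (Y := Y) ℓ).1
  refine ⟨R + ℓ.len γ, add_nonneg hR (ℓ.nonneg γ), fun f g ⟨r, hr, hfg⟩ => ?_⟩
  rw [← ContinuousLinearMap.comp_assoc, ← ContinuousLinearMap.comp_assoc, mulOp_comp_koopman,
    ContinuousLinearMap.comp_assoc, ContinuousLinearMap.comp_assoc, hT,
    ContinuousLinearMap.comp_zero]
  refine ⟨r - ℓ.len γ, by linarith, fun x hx y hy => ?_⟩
  have h1 := hfg _ (mem_tsupport_translate hx) y hy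
  have h2 := hw.1.triangle (γ • x) x y
  have h3 := hw.2.2 γ x
  rw [hw.1.symm] at h3
  linarith [hw.2.1 x y]

theorem normalizes_fpStar (hns : IsNonsingular Γ μ)
    (hLip : ∀ γ : Γ, ∃ K : NNReal, LipschitzWith K (fun y : Y => γ • y)) :
    Normalizes hns (fpStar (dist : Y → Y → ℝ) μ) := by
  rintro γ T ⟨R, hR, hT⟩
  obtain ⟨K, hK⟩ := hLip γ
  -- `K + 1` instead of `K`, since the estimate divides by it and `K` may be `0`.
  refine ⟨(K + 1) * R, by positivity, fun f g ⟨r, hr, hfg⟩ => ?_⟩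
  have hK1 : (0 : ℝ) < K + 1 := by positivity
  have h0 := hT (translate γ f) (translate γ g) ⟨r / (K + 1), by
    rwa [lt_div_iff₀ hK1, mul_comm], fun x hx y hy => by
      rw [div_le_iff₀ hK1]
      have h1 := hfg _ (mem_tsupport_translate hx) _ (mem_tsupport_translate hy)
      have h2 := hK.dist_le_mul x y
      linarith [dist_nonneg (x := x) (y := y)]⟩
  have h1 : koopman hns γ⁻¹ ∘L mulOp μ g = mulOp μ (translate γ g) ∘L koopman hns γ⁻¹ := by
    simpa using koopman_comp_mulOp hns γ⁻¹ g
  calc mulOp μ f ∘L (koopman hns γ ∘L T ∘L ContinuousLinearMap.adjoint (koopman hns γ)) ∘L mulOp μ g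
      = (mulOp μ f ∘L koopman hns γ) ∘L T ∘L (koopman hns γ⁻¹ ∘L mulOp μ g) := by
        rw [adjoint_koopman]
        rfl
    _ = koopman hns γ ∘L (mulOp μ (translate γ f) ∘L T ∘L mulOp μ (translate γ g)) ∘L
          koopman hns γ⁻¹ := by
        rw [mulOp_comp_koopman, h1]
        rfl
    _ = 0 := by rw [h0]; simp

theorem normalizes_roeStar (hns : IsNonsingular Γ μ)
    (hLip : ∀ γ : Γ, ∃ K : NNReal, LipschitzWith K (fun y : Y => γ • y)) :
    Normalizes hns (roeStar (dist : Y → Y → ℝ) μ) := fun γ T hT => by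
  refine ⟨normalizes_fpStar hns hLip γ T hT.1, ?_⟩
  rw [adjoint_koopman]
  exact isLocallyCompactOp_koopman_comp hns γ (isLocallyCompactOp_comp_koopman hns γ⁻¹ hT.2)

variable [ProperSpace Y]

theorem fpStar_warpedDist (hns : IsNonsingular Γ μ)
    (hLip : ∀ γ : Γ, ∃ K : NNReal, LipschitzWith K (fun y : Y => γ • y))
    (hbg : HasBoundedGeometry Y) (ℓ : ProperLengthFunction Γ) :
    fpStar (warpedDist ℓ) μ = groupSpan hns (fpStar (dist : Y → Y → ℝ) μ) := by
  refine le_antisymm (fun T hT => ?_) (Submodule.span_le.2 ?_)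
  · obtain ⟨S, T', rfl, hT'⟩ := exists_decomposition hns hLip hbg ℓ hT
    exact sum_mem_groupSpan hns fun γ => (hT' γ).1
  · rintro _ ⟨γ, b, hb, rfl⟩
    exact koopman_comp_mem_fpStar_warpedDist hns ℓ γ hb

theorem roeStar_warpedDist (hns : IsNonsingular Γ μ)
    (hLip : ∀ γ : Γ, ∃ K : NNReal, LipschitzWith K (fun y : Y => γ • y))
    (hbg : HasBoundedGeometry Y) (ℓ : ProperLengthFunction Γ) :
    roeStar (warpedDist ℓ) μ = groupSpan hns (roeStar (dist : Y → Y → ℝ) μ) := by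
  refine le_antisymm (fun T hT => ?_) (Submodule.span_le.2 ?_)
  · obtain ⟨S, T', h, hT'⟩ := exists_decomposition hns hLip hbg ℓ hT.1
    rw [h]
    exact sum_mem_groupSpan hns fun γ =>
      ⟨(hT' γ).1, isLocallyCompactOp_koopman_comp hns γ⁻¹ ((hT' γ).2 hT.2)⟩
  · rintro _ ⟨γ, b, hb, rfl⟩
    exact ⟨koopman_comp_mem_fpStar_warpedDist hns ℓ γ hb.1,
      isLocallyCompactOp_koopman_comp hns γ hb.2⟩

end Main

end WarpedRoe

end

theorem mainTheorem5
    {Γ : Type*} [Group Γ] [Countable Γ]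
    {Y : Type*} [MetricSpace Y] [ProperSpace Y] [MeasurableSpace Y] [BorelSpace Y]
    [MulAction Γ Y] (μ : MeasureTheory.Measure Y) [MeasureTheory.SigmaFinite μ]
    (hns : WarpedRoe.IsNonsingular Γ μ)
    (hLip : ∀ γ : Γ, ∃ K : NNReal, LipschitzWith K (fun y : Y => γ • y))
    (hbg : WarpedRoe.HasBoundedGeometry Y)
    (ℓ : WarpedRoe.ProperLengthFunction Γ) :
    -- finite propagation algebras
    (WarpedRoe.Normalizes hns (WarpedRoe.fpStar (dist : Y → Y → ℝ) μ) ∧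
      WarpedRoe.Normalizes hns (WarpedRoe.fpCStar (dist : Y → Y → ℝ) μ) ∧
      WarpedRoe.fpStar (WarpedRoe.warpedDist ℓ) μ =
        WarpedRoe.groupSpan hns (WarpedRoe.fpStar (dist : Y → Y → ℝ) μ) ∧
      WarpedRoe.fpCStar (WarpedRoe.warpedDist ℓ) μ =
        (WarpedRoe.groupSpan hns
          (WarpedRoe.fpCStar (dist : Y → Y → ℝ) μ)).topologicalClosure) ∧
    -- Roe algebras
    (WarpedRoe.IsAmple μ →
      WarpedRoe.Normalizes hns (WarpedRoe.roeStar (dist : Y → Y → ℝ) μ) ∧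
      WarpedRoe.Normalizes hns (WarpedRoe.roeCStar (dist : Y → Y → ℝ) μ) ∧
      WarpedRoe.roeStar (WarpedRoe.warpedDist ℓ) μ =
        WarpedRoe.groupSpan hns (WarpedRoe.roeStar (dist : Y → Y → ℝ) μ) ∧
      WarpedRoe.roeCStar (WarpedRoe.warpedDist ℓ) μ =
        (WarpedRoe.groupSpan hns
          (WarpedRoe.roeCStar (dist : Y → Y → ℝ) μ)).topologicalClosure) := by
  -- Lipschitz maps are continuous, which makes translation act on `C₀(Y)`.
  have hcont : ContinuousConstSMul Γ Y := ⟨fun γ => (hLip γ).choose_spec.continuous⟩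
  have hfp := WarpedRoe.fpStar_warpedDist hns hLip hbg ℓ
  have hroe := WarpedRoe.roeStar_warpedDist hns hLip hbg ℓ
  refine ⟨⟨WarpedRoe.normalizes_fpStar hns hLip,
    (WarpedRoe.normalizes_fpStar hns hLip).topologicalClosure, hfp, ?_⟩,
    fun _ => ⟨WarpedRoe.normalizes_roeStar hns hLip,
      (WarpedRoe.normalizes_roeStar hns hLip).topologicalClosure, hroe, ?_⟩⟩
  · exact (congrArg Submodule.topologicalClosure hfp).trans
      (WarpedRoe.topologicalClosure_groupSpan hns _)
  · exact (congrArg Submodule.topologicalClosure hroe).trans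
      (WarpedRoe.topologicalClosure_groupSpan hns _)
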